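/- Let $M$ be a combinatorial $3$-manifold, that is, a finite pure $3$-dimensional simplicial complex all of whose vertex links are combinatorial $2$-spheres (PL homeomorphic to the boundary of a tetrahedron). Let $f:|M|\to\mathbb{R}$ be a regular simplexwise linear function (linear on each simplex, with distinct values at distinct vertices), let $x\in\mathbb{R}$ be different from $f(v)$ for every vertex $v$, and let $S=f^{-1}(x)$ be the resulting slicing, viewed as a polyhedral complex whose cells are its nonempty intersections with the simplices of $M$ (so that its $2$-dimensional cells are triangles and quadrilaterals). Let $V_1$ and $V_2$ be the sets of vertices $v$ of $M$ with $f(v)<x$ and $f(v)>x$ respectively, and for $i=1,2$ let $\operatorname{span}(V_i)$ be the subcomplex of $M$ consisting of all simplices with vertices in $V_i$. Assume that $S$ is (nonempty and) connected, let $q$ be its number of quadrilaterals, and let $g$ be its genus, defined by $\chi(S)=2-2g$ (whether or not $S$ is orientable). 1. If $\dim(\operatorname{span}(V_i))=1$ for $i=1$ or $i=2$, then for such an $i$, with $n=|V_i|$, $$q\ \geq\ 3(n+g-1).$$ 2. In particular, this applies to every quadrangulated slicing of a connected $M$: if $M$ is connected and all $2$-dimensional cells of $S$ are quadrilaterals,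 then $\dim(\operatorname{span}(V_i))=1$ and $q\geq 3(|V_i|+g-1)$ for both $i=1$ and $i=2$. -/

import Mathlib

/-! ### Combinatorial manifolds -/

namespace CombSlicing

/-- `K` has dimension exactly `d`: it has a face with `d + 1` vertices and none with more. -/
def HasDim {V : Type*} (K : PreAbstractSimplicialComplex V) (d : ℕ) : Prop :=
  (∃ s ∈ K.faces, s.card = d + 1) ∧ ∀ s ∈ K.faces, s.card ≤ d + 1

/-- The link of the vertex `v` in `K`. -/
def link {V : Type*} [DecidableEq V] (K : PreAbstractSimplicialComplex V) (v : V) :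
    PreAbstractSimplicialComplex V where
  faces := {s | s.Nonempty ∧ v ∉ s ∧ insert v s ∈ K.faces}
  isRelLowerSet_faces := by
    rintro s ⟨hs, hv, hK⟩
    refine ⟨hs, fun t hts ht => ⟨ht, fun h => hv (hts h), ?_⟩⟩
    exact (K.isRelLowerSet_faces hK).2 (Finset.insert_subset_insert v hts)
      (Finset.insert_nonempty v t)

/-- `span W`: the full subcomplex of `K` induced by the set of vertices `W`. -/
def inducedSpan {V : Type*} (K : PreAbstractSimplicialComplex V) (W : Finset V) :
    PreAbstractSimplicialComplex V where
  faces := {s | s ∈ K.faces ∧ s ⊆ W}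
  isRelLowerSet_faces := by
    rintro s ⟨hs, hW⟩
    refine ⟨(K.isRelLowerSet_faces hs).1, fun t hts ht => ⟨?_, fun _ h => hW (hts h)⟩⟩
    exact (K.isRelLowerSet_faces hs).2 hts ht

/-- The boundary complex of the `d`-simplex with vertices `0, …, d`. -/
def simplexBoundary (d : ℕ) : PreAbstractSimplicialComplex ℕ where
  faces := {s | s.Nonempty ∧ s ⊂ Finset.range (d + 1)}
  isRelLowerSet_faces := by
    rintro s ⟨hs, hd⟩
    exact ⟨hs, fun t hts ht => ⟨ht, lt_of_le_of_lt hts hd⟩⟩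

/-- `L` is obtained from `K` by a stellar subdivision: for a face `σ` of `K` and a new vertex `a`,
the open star of `σ` is removed and replaced by the join `a * ∂σ * link(σ)`.  The sets `τ` in
the second part below are exactly the unions of a proper, possibly empty, subset of `σ` with a
possibly empty face of the link of `σ`. -/
def IsStellarSubdivision {V : Type*} [DecidableEq V] (K L : PreAbstractSimplicialComplex V) :
    Prop :=
  ∃ σ ∈ K.faces, ∃ a : V, {a} ∉ K.faces ∧
    L.faces = {τ | τ ∈ K.faces ∧ ¬ σ ⊆ τ} ∪
      {ρ | ∃ τ : Finset V, ¬ σ ⊆ τ ∧ τ ∪ σ ∈ K.faces ∧ ρ = insert a τ}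

/-- Combinatorial (piecewise linear) equivalence of simplicial complexes: the equivalence relation
generated by stellar subdivisions. (Subdividing at a vertex just renames this vertex, so
isomorphic finite complexes on an infinite supply of vertices are equivalent.) -/
def CombEquivalent {V : Type*} [DecidableEq V] (K L : PreAbstractSimplicialComplex V) : Prop :=
  Relation.EqvGen IsStellarSubdivision K L

/-- `K` is a combinatorial `(d - 1)`-sphere (with its standard PL structure): after its vertices
are labelled by natural numbers, it is combinatorially equivalent to the boundary of the
`d`-simplex. -/
def IsCombSphereBoundary {V : Type*} (d : ℕ) (K : PreAbstractSimplicialComplex V) : Prop :=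
  ∃ φ : V → ℕ, Function.Injective φ ∧ CombEquivalent (K.map φ) (simplexBoundary d)

/-- A combinatorial `d`-manifold: a pure `d`-dimensional simplicial complex all of whose vertex
links are combinatorial `(d - 1)`-spheres. -/
def IsCombManifold {V : Type*} [DecidableEq V] (d : ℕ) (M : AbstractSimplicialComplex V) : Prop :=
  (∀ s ∈ M.faces, s.card ≤ d + 1) ∧
  (∀ s ∈ M.faces, ∃ t ∈ M.faces, s ⊆ t ∧ t.card = d + 1) ∧
  ∀ v : V, IsCombSphereBoundary d (link M.toPreAbstractSimplicialComplex v)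

/-! ### Geometric realization, rsl-functions and slicings -/

section
variable {V : Type*} [Fintype V] [DecidableEq V]

/-- The closed geometric simplex with vertex set `σ`, in barycentric coordinates. -/
def closedSimplex (σ : Finset V) : Set (V → ℝ) :=
  {p | p ∈ stdSimplex ℝ V ∧ ∀ v, v ∉ σ → p v = 0}

/-- The geometric realization `|M|`. -/
def realization (M : AbstractSimplicialComplex V) : Set (V → ℝ) :=
  ⋃ σ ∈ M.faces, closedSimplex σ

/-- The vertex `v` as a point of the geometric realization. -/
def vertexPoint (v : V) : V → ℝ := Pi.single v 1

/-- `f` (a function of which only the values on `|M|` matter) is regular simplexwise linear: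
it takes distinct values at distinct vertices and is linear on each simplex of `M`. -/
def IsRsl (M : AbstractSimplicialComplex V) (f : (V → ℝ) → ℝ) : Prop :=
  (∀ v w : V, v ≠ w → f (vertexPoint v) ≠ f (vertexPoint w)) ∧
  ∀ σ ∈ M.faces, ∀ p ∈ closedSimplex σ, f p = ∑ v ∈ σ, p v * f (vertexPoint v)

/-- The level set of `f : |M| → ℝ` at `x`. -/
def slicing (M : AbstractSimplicialComplex V) (f : (V → ℝ) → ℝ) (x : ℝ) : Set (V → ℝ) :=
  {p | p ∈ realization M ∧ f p = x}

/-- The vertices of `M` below level `x`. -/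
noncomputable def lowerVertices (f : (V → ℝ) → ℝ) (x : ℝ) : Finset V :=
  Finset.univ.filter fun v => f (vertexPoint v) < x

/-- The vertices of `M` above level `x`. -/
noncomputable def upperVertices (f : (V → ℝ) → ℝ) (x : ℝ) : Finset V :=
  Finset.univ.filter fun v => x < f (vertexPoint v)

/-- The cells of the slicing as a polyhedral complex: its nonempty intersections with the closed
simplices of `M`. -/
def cells (M : AbstractSimplicialComplex V) (f : (V → ℝ) → ℝ) (x : ℝ) : Set (Set (V → ℝ)) :=
  {C | C.Nonempty ∧ ∃ σ ∈ M.faces, C = {p | p ∈ closedSimplex σ ∧ f p = x}}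

/-- The dimension of a convex cell. -/
noncomputable def cellDim (C : Set (V → ℝ)) : ℕ := Module.finrank ℝ (vectorSpan ℝ C)

/-- A convex cell that is a quadrilateral: a convex polygon with exactly four vertices. -/
def IsQuad (C : Set (V → ℝ)) : Prop :=
  cellDim C = 2 ∧ (Set.extremePoints ℝ C).ncard = 4

/-- The number of quadrilaterals of the slicing. -/
noncomputable def numQuads (M : AbstractSimplicialComplex V) (f : (V → ℝ) → ℝ) (x : ℝ) : ℕ :=
  {C | C ∈ cells M f x ∧ IsQuad C}.ncard

/-- All two-dimensional cells of the slicing are quadrilaterals. -/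
def IsQuadrangulated (M : AbstractSimplicialComplex V) (f : (V → ℝ) → ℝ) (x : ℝ) : Prop :=
  ∀ C ∈ cells M f x, cellDim C = 2 → IsQuad C

/-- The Euler characteristic of the slicing. -/
noncomputable def eulerChar (M : AbstractSimplicialComplex V) (f : (V → ℝ) → ℝ) (x : ℝ) : ℤ :=
  ∑ᶠ C ∈ cells M f x, (-1 : ℤ) ^ cellDim C

/-- The genus `g` of the slicing `S`, given by `χ(S) = 2 - 2 g`; this is the convention for
nonorientable surfaces too. -/
noncomputable def genus (M : AbstractSimplicialComplex V) (f : (V → ℝ) → ℝ) (x : ℝ) : ℚ :=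
  1 - (eulerChar M f x : ℚ) / 2

end

end CombSlicing

/-! A cell of the slicing `S` is cut out of a simplex of `M` with vertices on both sides of `x` (a
mixed simplex). It determines that simplex and has dimension two less than its number of vertices. A
tetrahedron gives a quadrilateral exactly when it is split 2+2. Hence `χ(S)` and `q` are signed or
plain counts of mixed faces.

Part 1. Vertex links have the Euler characteristics of spheres at every face
(`IsCombSphereBoundary.hasEulerSums`), so the signs `(-1) ^ #t` of the faces `t` containing a fixed
nonempty face sum to 1. Double counting pairs `p ⊆ t` with `p` spanned by `A = V_i` then yields
`χ(S) = 2 χ(span A)` (`IsCombManifold.sum_mixedFaces`). If `span A` is a graph with `n` vertices and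
`e` edges, this reads `2 - 2g = 2(n - e)`, that is `e = n + g - 1`. Every edge lies in at least
three tetrahedra, and a tetrahedron containing an edge of `span A` has no further vertex in `A`. So
each edge accounts for at least three quadrilaterals, different edges for different ones, and `q ≥
3e`.

Part 2. If all 2-cells are quadrilaterals, no tetrahedron has exactly three vertices in `A`, so the
property of lying inside `A` passes between tetrahedra that share a triangle. A connected `M` is
strongly connected (`IsCombManifold.adjacency_class`), so one tetrahedron inside `A` would force all
of them inside and leave `S` empty. By purity `span A` has no triangles.

The only facts about PL spheres needed are the local Euler sums and strong connectivity. Both hold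
for the boundary of a simplex and are invariant under stellar subdivision in both directions. -/

/-! ### Local Euler sums and stellar subdivisions -/

namespace CombSlicing

open Finset

section
variable {V : Type*} [DecidableEq V]

/-- The signed number of members of `F` that contain `p`. -/
def eulerSum (F : Finset (Finset V)) (p : Finset V) : ℤ :=
  ∑ t ∈ F with p ⊆ t, (-1) ^ #t

/-- Toggling a vertex `b ∈ s \ p` in `t` changes neither `t ∪ s` nor whether `p ⊆ t`, and it flips
the sign. -/
theorem sum_toggle_eq_zero {F : Finset (Finset V)}
    (hF : ∀ s ∈ F, ∀ t ⊆ s, t ∈ F) {s p : Finset V} (hp : ¬ s ⊆ p) :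
    ∑ t ∈ F with p ⊆ t ∧ t ∪ s ∈ F, (-1 : ℤ) ^ #t = 0 := by
  obtain ⟨b, hbs, hbp⟩ := Finset.not_subset.mp hp
  have hu : ∀ t : Finset V, (symmDiff t {b}) ∪ s = t ∪ s := by
    intro t
    ext y
    simp only [Finset.mem_union, Finset.mem_symmDiff, Finset.mem_singleton]
    by_cases hy : y = b <;> simp [hy, hbs]
  refine Finset.sum_involution (fun t _ => symmDiff t {b}) ?_ ?_ ?_ ?_
  · intro t _
    by_cases hb : b ∈ t
    · have h1 : symmDiff t {b} = t.erase b := by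
        ext y
        simp only [Finset.mem_symmDiff, Finset.mem_singleton, Finset.mem_erase]
        by_cases hy : y = b <;> simp [hy, hb]
      rw [h1, ← Finset.card_erase_add_one hb, pow_succ]
      ring
    · have h1 : symmDiff t {b} = insert b t := by
        ext y
        simp only [Finset.mem_symmDiff, Finset.mem_singleton, Finset.mem_insert]
        by_cases hy : y = b <;> simp [hy, hb]
      rw [h1, Finset.card_insert_of_notMem hb, pow_succ]
      ring
  · intro t _ _ h
    have : b ∈ symmDiff t {b} ↔ b ∈ t := by rw [h]
    simp [Finset.mem_symmDiff] at this
  · intro t ht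
    simp only [Finset.mem_filter] at ht ⊢
    obtain ⟨_, h2, h3⟩ := ht
    have h4 := hu t
    refine ⟨hF _ h3 _ (h4 ▸ Finset.subset_union_left), ?_, h4 ▸ h3⟩
    intro y hy
    simp only [Finset.mem_symmDiff, Finset.mem_singleton]
    exact Or.inl ⟨h2 hy, fun h => hbp (h ▸ hy)⟩
  · intro t _
    simp

/-- The stellar subdivision at the level of finite families closed under passing to subsets. -/
def stellar (F : Finset (Finset V)) (s : Finset V) (a : V) : Finset (Finset V) :=
  {t ∈ F | ¬ s ⊆ t} ∪ ({t ∈ F | ¬ s ⊆ t ∧ t ∪ s ∈ F}).image (insert a)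

/-- This is the contribution of the cone faces `insert a t`, whence the exponent `#t + 1`. In the
vanishing sum of `sum_toggle_eq_zero`, the terms with `s ⊆ t` form the Euler sum at `p ∪ s`, and the
others must cancel them. -/
theorem sum_stellar_new {F : Finset (Finset V)}
    (hF : ∀ s ∈ F, ∀ t ⊆ s, t ∈ F) {s p : Finset V} (hp : ¬ s ⊆ p) :
    ∑ t ∈ F with (¬ s ⊆ t ∧ t ∪ s ∈ F) ∧ p ⊆ t, (-1 : ℤ) ^ (#t + 1) = eulerSum F (p ∪ s) := by
  have h := sum_toggle_eq_zero hF hp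
  rw [← Finset.sum_filter_add_sum_filter_not _ (fun t => s ⊆ t), Finset.filter_filter,
    Finset.filter_filter] at h
  have e1 : F.filter (fun t => (p ⊆ t ∧ t ∪ s ∈ F) ∧ s ⊆ t) = F.filter (fun t => p ∪ s ⊆ t) := by
    refine Finset.filter_congr fun t ht => ?_
    rw [Finset.union_subset_iff]
    constructor
    · rintro ⟨⟨h1, _⟩, h3⟩
      exact ⟨h1, h3⟩
    · rintro ⟨h1, h3⟩
      exact ⟨⟨h1, by rwa [Finset.union_eq_left.mpr h3]⟩, h3⟩
  have e2 : F.filter (fun t => (p ⊆ t ∧ t ∪ s ∈ F) ∧ ¬ s ⊆ t) =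
      F.filter (fun t => (¬ s ⊆ t ∧ t ∪ s ∈ F) ∧ p ⊆ t) := by
    refine Finset.filter_congr fun t _ => ?_
    tauto
  rw [e1, e2] at h
  simp only [pow_succ, mul_neg, mul_one, Finset.sum_neg_distrib]
  unfold eulerSum
  linarith

/-- The removed faces containing `p` are those containing `p ∪ s`; by `sum_stellar_new` the added
ones have the same signed count. -/
theorem eulerSum_stellar_old {F : Finset (Finset V)}
    (hF : ∀ s ∈ F, ∀ t ⊆ s, t ∈ F) {s p : Finset V} {a : V} (ha : ∀ t ∈ F, a ∉ t)
    (hp : ¬ s ⊆ p) (hap : a ∉ p) :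
    eulerSum (stellar F s a) p = eulerSum F p := by
  unfold eulerSum stellar
  rw [Finset.filter_union, Finset.sum_union, Finset.filter_image, Finset.sum_image]
  · have hc : ∀ t ∈ F, (p ⊆ insert a t ↔ p ⊆ t) := fun t _ =>
      ⟨fun h y hy => (Finset.mem_insert.mp (h hy)).resolve_left (fun e => hap (e ▸ hy)),
        fun h => h.trans (Finset.subset_insert _ _)⟩
    rw [Finset.filter_filter, Finset.filter_filter,
      ← Finset.sum_filter_add_sum_filter_not ({t ∈ F | p ⊆ t}) (fun t => s ⊆ t),
      Finset.filter_filter, Finset.filter_filter, add_comm]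
    congr 1
    · have h := sum_stellar_new hF hp
      unfold eulerSum at h
      simp only [Finset.union_subset_iff] at h
      rw [← h]
      refine Finset.sum_congr (Finset.filter_congr fun t ht => by rw [hc t ht]) fun t ht => ?_
      rw [Finset.card_insert_of_notMem (ha t (Finset.mem_filter.mp ht).1)]
    · refine Finset.sum_congr (Finset.filter_congr fun t ht => by tauto) fun t ht => rfl
  · intro t ht u hu h
    have h1 := ha t (by simp at ht; tauto)
    have h2 := ha u (by simp at hu; tauto)
    rw [← Finset.erase_insert h1, ← Finset.erase_insert h2, h]
  · rw [Finset.disjoint_left]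
    intro t ht hu
    simp only [Finset.mem_filter, Finset.mem_image] at ht hu
    obtain ⟨⟨u, _, rfl⟩, _⟩ := hu
    exact ha _ ht.1.1 (Finset.mem_insert_self _ _)

theorem eulerSum_stellar_new {F : Finset (Finset V)}
    (hF : ∀ s ∈ F, ∀ t ⊆ s, t ∈ F) {s p : Finset V} {a : V} (ha : ∀ t ∈ F, a ∉ t)
    (hp : ¬ s ⊆ p) (hap : a ∉ p) :
    eulerSum (stellar F s a) (insert a p) = eulerSum F (p ∪ s) := by
  rw [← sum_stellar_new hF hp]
  unfold eulerSum stellar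
  rw [Finset.filter_union, Finset.filter_image, Finset.filter_filter,
    Finset.filter_eq_empty_iff.mpr, Finset.empty_union, Finset.sum_image]
  · have hc : ∀ t ∈ F, (insert a p ⊆ insert a t ↔ p ⊆ t) := fun t ht =>
      Finset.insert_subset_insert_iff hap
    rw [Finset.filter_filter]
    refine Finset.sum_congr (Finset.filter_congr fun t ht => by rw [hc t ht]) fun t ht => ?_
    rw [Finset.card_insert_of_notMem (ha t (Finset.mem_filter.mp ht).1)]
  · intro t ht u hu h
    have h1 := ha t (by simp at ht; tauto)
    have h2 := ha u (by simp at hu; tauto)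
    rw [← Finset.erase_insert h1, ← Finset.erase_insert h2, h]
  · intro t ht h
    exact ha t ht (h.2 (Finset.mem_insert_self _ _))

/-- `K` is finite and all its local Euler sums, that at the empty face included, equal `c`. -/
def HasEulerSums (c : ℤ) (K : PreAbstractSimplicialComplex V) : Prop :=
  ∃ F : Finset (Finset V), (∀ s, s ∈ F ↔ s ∈ K.faces ∨ s = ∅) ∧ ∀ p ∈ F, eulerSum F p = c

omit [DecidableEq V] in
theorem subset_mem_of_mem {K : PreAbstractSimplicialComplex V} {F : Finset (Finset V)}
    (hF : ∀ s, s ∈ F ↔ s ∈ K.faces ∨ s = ∅) : ∀ s ∈ F, ∀ t ⊆ s, t ∈ F := by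
  intro s hs t hts
  rw [hF] at hs ⊢
  rcases t.eq_empty_or_nonempty with h | h
  · exact Or.inr h
  · rcases hs with hs | rfl
    · exact Or.inl ((K.isRelLowerSet_faces hs).2 hts h)
    · exact Or.inr (Finset.subset_empty.mp hts)

omit [DecidableEq V] in
theorem notMem_of_singleton_notMem {K : PreAbstractSimplicialComplex V} {a : V}
    (ha : {a} ∉ K.faces) {t : Finset V} (ht : t ∈ K.faces) : a ∉ t := fun h =>
  ha ((K.isRelLowerSet_faces ht).2 (Finset.singleton_subset_iff.mpr h)
    (Finset.singleton_nonempty a))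

theorem mem_stellar_iff {K L : PreAbstractSimplicialComplex V} {F : Finset (Finset V)}
    (hF : ∀ s, s ∈ F ↔ s ∈ K.faces ∨ s = ∅) {s : Finset V} (hs : s ∈ K.faces) {a : V}
    (hL : L.faces = {τ | τ ∈ K.faces ∧ ¬ s ⊆ τ} ∪
      {ρ | ∃ τ : Finset V, ¬ s ⊆ τ ∧ τ ∪ s ∈ K.faces ∧ ρ = insert a τ}) (t : Finset V) :
    t ∈ stellar F s a ↔ t ∈ L.faces ∨ t = ∅ := by
  have hsne := (K.isRelLowerSet_faces hs).1
  have hdown := subset_mem_of_mem hF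
  have hun : ∀ τ : Finset V, τ ∪ s ∈ F ↔ τ ∪ s ∈ K.faces := fun τ => by
    rw [hF]
    refine ⟨fun h => h.resolve_right ?_, Or.inl⟩
    exact (hsne.mono Finset.subset_union_right).ne_empty
  unfold stellar
  rw [hL]
  simp only [Finset.mem_union, Finset.mem_filter, Finset.mem_image, Set.mem_union,
    Set.mem_ofPred_eq, hun]
  constructor
  · rintro (⟨h1, h2⟩ | ⟨τ, ⟨_, h2, h3⟩, rfl⟩)
    · rcases (hF t).mp h1 with h | h
      · exact Or.inl (Or.inl ⟨h, h2⟩)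
      · exact Or.inr h
    · exact Or.inl (Or.inr ⟨τ, h2, h3, rfl⟩)
  · rintro ((⟨h1, h2⟩ | ⟨τ, h2, h3, rfl⟩) | rfl)
    · exact Or.inl ⟨(hF t).mpr (Or.inl h1), h2⟩
    · exact Or.inr ⟨τ, ⟨hdown _ ((hun τ).mpr h3) _ Finset.subset_union_left, h2, h3⟩, rfl⟩
    · refine Or.inl ⟨(hF _).mpr (Or.inr rfl), fun h => ?_⟩
      exact hsne.ne_empty (Finset.subset_empty.mp h)

/-- Every local sum of one complex occurs as a local sum of the other: the sum at a face not
containing `s` is unchanged, and the sum at the new face `insert a τ` is the old sum at `τ ∪ s`. -/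
theorem IsStellarSubdivision.hasEulerSums_iff {c : ℤ} {K L : PreAbstractSimplicialComplex V}
    (h : IsStellarSubdivision K L) : HasEulerSums c K ↔ HasEulerSums c L := by
  obtain ⟨s, hs, a, ha, hL⟩ := h
  have hsne := (K.isRelLowerSet_faces hs).1
  constructor
  · rintro ⟨F, hF, hE⟩
    have hdown := subset_mem_of_mem hF
    have haF : ∀ t ∈ F, a ∉ t := by
      intro t ht
      rcases (hF t).mp ht with h | rfl
      · exact notMem_of_singleton_notMem ha h
      · simp
    refine ⟨stellar F s a, mem_stellar_iff hF hs hL, fun p hp => ?_⟩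
    unfold stellar at hp
    simp only [Finset.mem_union, Finset.mem_filter, Finset.mem_image] at hp
    rcases hp with ⟨h1, h2⟩ | ⟨τ, ⟨h1, h2, h3⟩, rfl⟩
    · rw [eulerSum_stellar_old hdown haF h2 (haF p h1), hE p h1]
    · rw [eulerSum_stellar_new hdown haF h2 (haF τ h1), hE _ h3]
  · rintro ⟨G, hG, hE⟩
    -- Finiteness has to be recovered as well: a face `t ⊇ s` lost in the subdivision is rebuilt
    -- from `insert a (t \ s)` by erasing `a` and adding `s`.
    have hfin : {t | t ∈ K.faces ∨ t = ∅}.Finite := by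
      refine Set.Finite.subset
        (Finset.finite_toSet (G ∪ G.image (fun r => r.erase a ∪ s))) fun t ht => ?_
      simp only [Finset.coe_union, Finset.coe_image, Set.mem_union, Finset.mem_coe, Set.mem_image]
      rcases ht with ht | rfl
      · by_cases hst : s ⊆ t
        · right
          refine ⟨insert a (t \ s), (hG _).mpr (Or.inl ?_), ?_⟩
          · rw [hL]
            refine Or.inr ⟨t \ s, fun h => ?_, by rwa [Finset.sdiff_union_of_subset hst], rfl⟩
            obtain ⟨y, hy⟩ := hsne
            exact (Finset.mem_sdiff.mp (h hy)).2 hy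
          · rw [Finset.erase_insert, Finset.sdiff_union_of_subset hst]
            exact fun h => notMem_of_singleton_notMem ha ht (Finset.mem_sdiff.mp h).1
        · exact Or.inl ((hG _).mpr (Or.inl (hL ▸ Or.inl ⟨ht, hst⟩)))
      · exact Or.inl ((hG _).mpr (Or.inr rfl))
    have hF : ∀ t, t ∈ hfin.toFinset ↔ t ∈ K.faces ∨ t = ∅ := fun t => by simp
    generalize hfin.toFinset = F at hF
    have hdown := subset_mem_of_mem hF
    have haF : ∀ t ∈ F, a ∉ t := by
      intro t ht
      rcases (hF t).mp ht with h | rfl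
      · exact notMem_of_singleton_notMem ha h
      · simp
    have hGF : G = stellar F s a := by
      ext t
      rw [hG, mem_stellar_iff hF hs hL]
    refine ⟨F, hF, fun p hp => ?_⟩
    by_cases hsp : s ⊆ p
    · have h1 : ¬ s ⊆ p \ s := fun h => by
        obtain ⟨y, hy⟩ := hsne
        exact (Finset.mem_sdiff.mp (h hy)).2 hy
      have h2 := hdown p hp _ (Finset.sdiff_subset (s := p) (t := s))
      have h3 := eulerSum_stellar_new hdown haF h1 (haF _ h2)
      rw [Finset.sdiff_union_of_subset hsp] at h3
      rw [← h3, ← hGF]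
      refine hE _ ?_
      rw [hGF]
      unfold stellar
      refine Finset.mem_union_right _ (Finset.mem_image_of_mem _ (Finset.mem_filter.mpr
        ⟨h2, h1, ?_⟩))
      rwa [Finset.sdiff_union_of_subset hsp]
    · rw [← eulerSum_stellar_old hdown haF hsp (haF p hp), ← hGF]
      refine hE _ ?_
      rw [hGF]
      exact Finset.mem_union_left _ (Finset.mem_filter.mpr ⟨hp, hsp⟩)

theorem CombEquivalent.iff_of_stellar {P : PreAbstractSimplicialComplex V → Prop}
    (hP : ∀ K L, IsStellarSubdivision K L → (P K ↔ P L)) {K L : PreAbstractSimplicialComplex V}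
    (h : CombEquivalent K L) : P K ↔ P L := by
  induction h with
  | rel _ _ h => exact hP _ _ h
  | refl => exact Iff.rfl
  | symm _ _ _ ih => exact ih.symm
  | trans _ _ _ _ _ ih1 ih2 => exact ih1.trans ih2

theorem HasEulerSums.of_map {W : Type*} [DecidableEq W] {c : ℤ}
    {K : PreAbstractSimplicialComplex W} {φ : W → V} (hφ : Function.Injective φ)
    (h : HasEulerSums c (K.map φ)) : HasEulerSums c K := by
  obtain ⟨F, hF, hE⟩ := h
  have hinj := Finset.image_injective hφ
  have hFi : ∀ s, s.image φ ∈ F ↔ s ∈ K.faces ∨ s = ∅ := by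
    intro s
    rw [hF, Finset.image_eq_empty]
    refine or_congr_left ⟨?_, fun h => ⟨s, h, rfl⟩⟩
    rintro ⟨t, ht, h⟩
    exact hinj h ▸ ht
  have hsurj : ∀ t ∈ F, ∃ s : Finset W, s.image φ = t := by
    intro t ht
    rcases (hF t).mp ht with ⟨s, _, h⟩ | rfl
    · exact ⟨s, h⟩
    · exact ⟨∅, rfl⟩
  refine ⟨F.preimage (Finset.image φ) hinj.injOn, fun s => by rw [Finset.mem_preimage, hFi],
    fun p hp => ?_⟩
  rw [Finset.mem_preimage] at hp
  rw [← hE _ hp]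
  unfold eulerSum
  refine Finset.sum_bij (fun s _ => s.image φ) ?_ ?_ ?_ ?_
  · intro s hs
    rw [Finset.mem_filter, Finset.mem_preimage] at hs
    exact Finset.mem_filter.mpr ⟨hs.1, Finset.image_subset_image hs.2⟩
  · exact fun s _ t _ h => hinj h
  · intro t ht
    rw [Finset.mem_filter] at ht
    obtain ⟨s, rfl⟩ := hsurj t ht.1
    refine ⟨s, ?_, rfl⟩
    rw [Finset.mem_filter, Finset.mem_preimage]
    exact ⟨ht.1, (Finset.image_subset_image_iff hφ).mp ht.2⟩
  · intro s _
    rw [Finset.card_image_of_injective _ hφ]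

/-- Over all sets between a proper subset `p` and the 4-element set the signs cancel; leaving out
the full set, of sign `+1`, gives `-1`. -/
theorem hasEulerSums_simplexBoundary_three : HasEulerSums (-1) (simplexBoundary 3) := by
  refine ⟨(Finset.range 4).ssubsets, fun s => ?_, ?_⟩
  · rw [Finset.mem_ssubsets]
    change _ ↔ (s.Nonempty ∧ s ⊂ Finset.range (3 + 1)) ∨ s = ∅
    rcases s.eq_empty_or_nonempty with rfl | h
    · simp [Finset.ssubset_iff_subset_ne]
      decide
    · simp [h, h.ne_empty]
  · decide

end

end CombSlicing

/-! ### Strong connectivity -/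

namespace CombSlicing

open Finset

section
variable {V : Type*} [DecidableEq V]

/-- `c` is constant along pairs of `d`-element faces of `K` that share at least `d - 1` vertices. -/
def RespectsAdjacency (d : ℕ) (K : PreAbstractSimplicialComplex V) (c : Finset V → Prop) : Prop :=
  ∀ t ∈ K.faces, ∀ u ∈ K.faces, #t = d → #u = d → d ≤ #(t ∩ u) + 1 → (c t ↔ c u)

/-- `K` has no faces with more than `d` vertices, and any two faces with `d` vertices are joined
by a chain of such faces in which neighbours share `d - 1` vertices. -/
def IsStronglyConnected (d : ℕ) (K : PreAbstractSimplicialComplex V) : Prop :=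
  (∀ t ∈ K.faces, #t ≤ d) ∧
  ∀ c : Finset V → Prop, RespectsAdjacency d K c →
    ∀ t ∈ K.faces, ∀ u ∈ K.faces, #t = d → #u = d → (c t ↔ c u)

section
variable {K L : PreAbstractSimplicialComplex V} {s : Finset V} {a : V} {d : ℕ}

theorem erase_union_of_subset {t : Finset V} {y : V} (hst : s ⊆ t) (hy : y ∈ s) :
    t.erase y ∪ s = t := by
  ext z
  simp only [Finset.mem_union, Finset.mem_erase]
  by_cases hz : z = y
  · subst hz
    simp [hy, hst hy]
  · exact ⟨fun h => h.elim And.right (fun h => hst h), fun h => Or.inl ⟨hz, h⟩⟩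

/-- These are the pieces into which the subdivision cuts a face `t ⊇ s`, one for each vertex `y` of
`s`, with `a` in the place of `y`. -/
theorem mem_of_subset_of_mem_insert {t : Finset V} {y : V}
    (hL : L.faces = {τ | τ ∈ K.faces ∧ ¬ s ⊆ τ} ∪
      {ρ | ∃ τ : Finset V, ¬ s ⊆ τ ∧ τ ∪ s ∈ K.faces ∧ ρ = insert a τ})
    (ht : t ∈ K.faces) (hst : s ⊆ t) (hy : y ∈ s) : insert a (t.erase y) ∈ L.faces := by
  rw [hL]
  refine Or.inr ⟨t.erase y, fun h => Finset.notMem_erase y t (h hy), ?_, rfl⟩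
  rwa [erase_union_of_subset hst hy]

theorem card_insert_erase {t : Finset V} {y : V} (ha : a ∉ t) (hy : y ∈ t) :
    #(insert a (t.erase y)) = #t := by
  rw [Finset.card_insert_of_notMem (fun h => ha (Finset.mem_of_mem_erase h)),
    Finset.card_erase_add_one hy]

theorem card_lt_card_union_of_not_subset {t : Finset V} (h : ¬ s ⊆ t) : #t < #(t ∪ s) := by
  refine Finset.card_lt_card ((Finset.ssubset_iff_subset_ne).mpr
    ⟨Finset.subset_union_left, fun e => h ?_⟩)
  rw [e]
  exact Finset.subset_union_right

/-- A colouring of the facets of `K` is pulled back to `L` by sending each facet to the facet of `K`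
it was cut from. Adjacent facets of `L` have equal or adjacent parents, so the pulled-back colouring
still respects adjacency. -/
theorem IsStronglyConnected.of_isStellarSubdivision
    (h : IsStellarSubdivision K L) (hL' : IsStronglyConnected d L) : IsStronglyConnected d K := by
  obtain ⟨s, hs, a, ha, hL⟩ := h
  obtain ⟨y, hy⟩ := (K.isRelLowerSet_faces hs).1
  have haK : ∀ t ∈ K.faces, a ∉ t := fun t ht => notMem_of_singleton_notMem ha ht
  obtain ⟨hdim, hconn⟩ := hL'
  have hdimK : ∀ t ∈ K.faces, #t ≤ d := by
    intro t ht
    by_cases hst : s ⊆ t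
    · rw [← card_insert_erase (haK t ht) (hst hy)]
      exact hdim _ (mem_of_subset_of_mem_insert hL ht hst hy)
    · exact hdim _ (hL ▸ Or.inl ⟨ht, hst⟩)
  refine ⟨hdimK, fun c hc t ht u hu hct hcu => ?_⟩
  have hpar : ∀ t ∈ K.faces, #t = d → ∃ r ∈ L.faces, #r = d ∧
      ((a ∉ r ∧ r = t) ∨ (a ∈ r ∧ r.erase a ∪ s = t)) := by
    intro t ht hct
    by_cases hst : s ⊆ t
    · refine ⟨_, mem_of_subset_of_mem_insert hL ht hst hy,
        by rw [card_insert_erase (haK t ht) (hst hy), hct],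
        Or.inr ⟨Finset.mem_insert_self _ _, ?_⟩⟩
      rw [Finset.erase_insert (fun h => haK t ht (Finset.mem_of_mem_erase h)),
        erase_union_of_subset hst hy]
    · exact ⟨t, hL ▸ Or.inl ⟨ht, hst⟩, hct, Or.inl ⟨haK t ht, rfl⟩⟩
  let par : Finset V → Finset V := fun r => if a ∈ r then r.erase a ∪ s else r
  have hfacet : ∀ r ∈ L.faces, #r = d → (a ∉ r ∧ r ∈ K.faces ∧ par r = r) ∨
      ∃ τ : Finset V, a ∉ τ ∧ ¬ s ⊆ τ ∧ τ ∪ s ∈ K.faces ∧ r = insert a τ ∧ par r = τ ∪ s ∧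
        #τ + 1 = d ∧ #(τ ∪ s) = d := by
    intro r hr hcr
    rw [hL] at hr
    rcases hr with ⟨h1, _⟩ | ⟨τ, h1, h2, rfl⟩
    · exact Or.inl ⟨haK r h1, h1, if_neg (haK r h1)⟩
    · have haτ : a ∉ τ := fun h => haK _ h2 (Finset.mem_union_left _ h)
      have e1 : #τ + 1 = d := by rw [← hcr, Finset.card_insert_of_notMem haτ]
      have e2 := card_lt_card_union_of_not_subset h1
      have e3 := hdimK _ h2
      refine Or.inr ⟨τ, haτ, h1, h2, rfl, ?_, e1, by omega⟩
      simp only [par, Finset.mem_insert_self, if_true, Finset.erase_insert haτ]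
  have hresp : RespectsAdjacency d L (fun r => c (par r)) := by
    intro r hr q hq hcr hcq hrq
    rcases hfacet r hr hcr with ⟨h1, h2, h3⟩ | ⟨τ, h1, h2, h3, h4, h5, h6, h7⟩ <;>
    rcases hfacet q hq hcq with ⟨k1, k2, k3⟩ | ⟨η, k1, k2, k3, k4, k5, k6, k7⟩
    · simp only [h3, k3]
      exact hc r h2 q k2 hcr hcq hrq
    · simp only [h3, k5]
      refine hc r h2 _ k3 hcr k7 (hrq.trans (Nat.add_le_add_right (Finset.card_le_card ?_) 1))
      rw [k4]
      intro z hz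
      simp only [Finset.mem_inter, Finset.mem_insert, Finset.mem_union] at hz ⊢
      refine ⟨hz.1, Or.inl (hz.2.resolve_left ?_)⟩
      rintro rfl
      exact h1 hz.1
    · simp only [h5, k3]
      refine hc _ h3 q k2 h7 hcq (hrq.trans (Nat.add_le_add_right (Finset.card_le_card ?_) 1))
      rw [h4]
      intro z hz
      simp only [Finset.mem_inter, Finset.mem_insert, Finset.mem_union] at hz ⊢
      refine ⟨Or.inl (hz.1.resolve_left ?_), hz.2⟩
      rintro rfl
      exact k1 hz.2
    · simp only [h5, k5]
      refine hc _ h3 _ k3 h7 k7 ?_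
      have e1 : #(r ∩ q) = #(τ ∩ η) + 1 := by
        rw [h4, k4, ← Finset.insert_inter_distrib, Finset.card_insert_of_notMem]
        exact fun h => h1 (Finset.mem_inter.mp h).1
      -- The parents meet in `(τ ∩ η) ∪ s`. This has at least one more vertex than `τ ∩ η`, which
      -- makes up for the loss of `a`.
      have e2 : ¬ s ⊆ τ ∩ η := fun h => h2 (h.trans Finset.inter_subset_left)
      have e3 := card_lt_card_union_of_not_subset e2
      rw [Finset.union_comm, Finset.union_inter_distrib_left, Finset.union_comm s τ,
        Finset.union_comm s η] at e3
      omega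
  obtain ⟨r, hr, hcr, hrt⟩ := hpar t ht hct
  obtain ⟨q, hq, hcq, hqu⟩ := hpar u hu hcu
  have e1 : par r = t := by
    rcases hrt with ⟨h1, h2⟩ | ⟨h1, h2⟩
    · rw [← h2]
      exact if_neg h1
    · simp only [par, if_pos h1, h2]
  have e2 : par q = u := by
    rcases hqu with ⟨h1, h2⟩ | ⟨h1, h2⟩
    · rw [← h2]
      exact if_neg h1
    · simp only [par, if_pos h1, h2]
  have := hconn _ hresp r hr q hq hcr hcq
  simpa only [e1, e2] using this

/-- The pieces of one facet of `K` are pairwise adjacent or equal, hence share a colour. Giving the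
facet this colour yields a colouring of `K`. -/
theorem IsStronglyConnected.isStellarSubdivision
    (h : IsStellarSubdivision K L) (hK : IsStronglyConnected d K) : IsStronglyConnected d L := by
  obtain ⟨s, hs, a, ha, hL⟩ := h
  obtain ⟨y, hy⟩ := (K.isRelLowerSet_faces hs).1
  have haK : ∀ t ∈ K.faces, a ∉ t := fun t ht => notMem_of_singleton_notMem ha ht
  obtain ⟨hdim, hconn⟩ := hK
  have hdimL : ∀ r ∈ L.faces, #r ≤ d := by
    intro r hr
    rw [hL] at hr
    rcases hr with ⟨h1, _⟩ | ⟨τ, h1, h2, rfl⟩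
    · exact hdim _ h1
    · have e1 := Finset.card_insert_le a τ
      have e2 := card_lt_card_union_of_not_subset h1
      have e3 := hdim _ h2
      omega
  refine ⟨hdimL, fun c hc r hr q hq hcr hcq => ?_⟩
  have hKL : ∀ t ∈ K.faces, ¬ s ⊆ t → t ∈ L.faces := fun t ht h => hL ▸ Or.inl ⟨ht, h⟩
  have hchild : ∀ t ∈ K.faces, #t = d → s ⊆ t → ∀ y ∈ s, ∀ z ∈ s,
      (c (insert a (t.erase y)) ↔ c (insert a (t.erase z))) := by
    intro t ht hct hst y hy z hz
    refine hc _ (mem_of_subset_of_mem_insert hL ht hst hy) _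
      (mem_of_subset_of_mem_insert hL ht hst hz) ?_ ?_ ?_
    · rw [card_insert_erase (haK t ht) (hst hy), hct]
    · rw [card_insert_erase (haK t ht) (hst hz), hct]
    · rw [← Finset.insert_inter_distrib, Finset.card_insert_of_notMem
        (fun h => haK t ht (Finset.mem_of_mem_erase (Finset.mem_inter.mp h).1))]
      have h1 : (t.erase y).erase z ⊆ t.erase y ∩ t.erase z := by
        intro w hw
        simp only [Finset.mem_inter, Finset.mem_erase] at hw ⊢
        tauto
      have h2 := Finset.card_le_card h1
      have h3 := Finset.pred_card_le_card_erase (s := t.erase y) (a := z)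
      have h4 := Finset.card_erase_add_one (hst hy)
      omega
  let ch : Finset V → Finset V := fun t => if s ⊆ t then insert a (t.erase y) else t
  have hresp : RespectsAdjacency d K (fun t => c (ch t)) := by
    intro t ht u hu hct hcu htu
    -- Only `t` is cut. The piece of `t` that omits some `z ∈ s \ u` still contains `t ∩ u`, so it
    -- is adjacent to `u`.
    have hmix : ∀ t ∈ K.faces, ∀ u ∈ K.faces, #t = d → #u = d → d ≤ #(t ∩ u) + 1 → s ⊆ t →
        ¬ s ⊆ u → (c (ch t) ↔ c (ch u)) := by
      intro t ht u hu hct hcu htu h1 h2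
      obtain ⟨z, hzs, hzu⟩ := Finset.not_subset.mp h2
      simp only [ch, if_pos h1, if_neg h2]
      rw [hchild t ht hct h1 y hy z hzs]
      refine hc _ (mem_of_subset_of_mem_insert hL ht h1 hzs) _ (hKL u hu h2)
        (by rw [card_insert_erase (haK t ht) (h1 hzs), hct]) hcu
        (htu.trans (Nat.add_le_add_right (Finset.card_le_card ?_) 1))
      intro w hw
      simp only [Finset.mem_inter, Finset.mem_insert, Finset.mem_erase] at hw ⊢
      exact ⟨Or.inr ⟨fun h => hzu (h ▸ hw.2), hw.1⟩, hw.2⟩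
    by_cases h1 : s ⊆ t <;> by_cases h2 : s ⊆ u
    · simp only [ch, if_pos h1, if_pos h2]
      refine hc _ (mem_of_subset_of_mem_insert hL ht h1 hy) _
        (mem_of_subset_of_mem_insert hL hu h2 hy) ?_ ?_ ?_
      · rw [card_insert_erase (haK t ht) (h1 hy), hct]
      · rw [card_insert_erase (haK u hu) (h2 hy), hcu]
      · rw [← Finset.insert_inter_distrib, Finset.card_insert_of_notMem
          (fun h => haK t ht (Finset.mem_of_mem_erase (Finset.mem_inter.mp h).1))]
        have h3 : (t ∩ u).erase y ⊆ t.erase y ∩ u.erase y := by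
          intro w hw
          simp only [Finset.mem_inter, Finset.mem_erase] at hw ⊢
          tauto
        have h4 := Finset.card_le_card h3
        have h5 := Finset.pred_card_le_card_erase (s := t ∩ u) (a := y)
        omega
    · exact hmix t ht u hu hct hcu htu h1 h2
    · exact (hmix u hu t ht hcu hct (by rwa [Finset.inter_comm]) h2 h1).symm
    · simp only [ch, if_neg h1, if_neg h2]
      exact hc t (hKL t ht h1) u (hKL u hu h2) hct hcu htu
  have hpar : ∀ r ∈ L.faces, #r = d → ∃ t ∈ K.faces, #t = d ∧ (c r ↔ c (ch t)) := by
    intro r hr hcr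
    have hr' := hr
    rw [hL] at hr'
    rcases hr' with ⟨h1, h2⟩ | ⟨τ, h1, h2, rfl⟩
    · exact ⟨r, h1, hcr, by simp only [ch, if_neg h2]⟩
    · have haτ : a ∉ τ := fun h => haK _ h2 (Finset.mem_union_left _ h)
      rw [Finset.card_insert_of_notMem haτ] at hcr
      have e2 := card_lt_card_union_of_not_subset h1
      have e3 := hdim _ h2
      have e4 : #(τ ∪ s) = d := by omega
      refine ⟨τ ∪ s, h2, e4, ?_⟩
      obtain ⟨z, hzs, hzτ⟩ := Finset.not_subset.mp h1
      have e5 : τ = (τ ∪ s).erase z := by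
        refine Finset.eq_of_subset_of_card_le (fun w hw => Finset.mem_erase.mpr
          ⟨fun h => hzτ (h ▸ hw), Finset.mem_union_left _ hw⟩) ?_
        rw [Finset.card_erase_of_mem (Finset.mem_union_right _ hzs)]
        omega
      have := hchild _ h2 e4 Finset.subset_union_right y hy z hzs
      rw [← e5] at this
      simp only [ch, if_pos (Finset.subset_union_right (s₁ := τ) (s₂ := s)), this]
  obtain ⟨t, ht, hct, h1⟩ := hpar r hr hcr
  obtain ⟨u, hu, hcu, h2⟩ := hpar q hq hcq
  rw [h1, h2]
  exact hconn _ hresp t ht u hu hct hcu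

end

/-- Any two `d`-subsets of a set of `d + 1` elements share at least `d - 1` elements. -/
theorem isStronglyConnected_simplexBoundary (d : ℕ) :
    IsStronglyConnected d (simplexBoundary d) := by
  refine ⟨fun t ht => ?_, fun c hc t ht u hu hct hcu => hc t ht u hu hct hcu ?_⟩
  · have := Finset.card_lt_card ht.2
    rw [Finset.card_range] at this
    omega
  · have h1 := Finset.card_le_card (Finset.union_subset ht.2.subset hu.2.subset)
    have h2 := Finset.card_union_add_card_inter t u
    rw [Finset.card_range] at h1
    omega

theorem IsStronglyConnected.of_map {W : Type*} [DecidableEq W] {d : ℕ}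
    {K : PreAbstractSimplicialComplex W} {φ : W → V} (hφ : Function.Injective φ)
    (h : IsStronglyConnected d (K.map φ)) : IsStronglyConnected d K := by
  have hinj := Finset.image_injective hφ
  refine ⟨fun t ht => ?_, fun c hc t ht u hu hct hcu => ?_⟩
  · rw [← Finset.card_image_of_injective t hφ]
    exact h.1 _ ⟨t, ht, rfl⟩
  · have := h.2 (fun r => ∃ t, t.image φ = r ∧ c t) ?_ _ ⟨t, ht, rfl⟩ _ ⟨u, hu, rfl⟩
      (by rw [Finset.card_image_of_injective t hφ, hct])
      (by rw [Finset.card_image_of_injective u hφ, hcu])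
    · simpa [hinj.eq_iff] using this
    · rintro _ ⟨t, ht, rfl⟩ _ ⟨u, hu, rfl⟩ hct hcu htu
      simp only [hinj.eq_iff, exists_eq_left]
      rw [Finset.card_image_of_injective _ hφ] at hct hcu
      rw [← Finset.image_inter _ _ hφ, Finset.card_image_of_injective _ hφ] at htu
      exact hc t ht u hu hct hcu htu

theorem IsCombSphereBoundary.hasEulerSums {K : PreAbstractSimplicialComplex V}
    (h : IsCombSphereBoundary 3 K) : HasEulerSums (-1) K := by
  obtain ⟨φ, hφ, h⟩ := h
  exact .of_map hφ ((h.iff_of_stellar fun _ _ h => h.hasEulerSums_iff).mpr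
    hasEulerSums_simplexBoundary_three)

theorem IsCombSphereBoundary.isStronglyConnected {d : ℕ} {K : PreAbstractSimplicialComplex V}
    (h : IsCombSphereBoundary d K) : IsStronglyConnected d K := by
  obtain ⟨φ, hφ, h⟩ := h
  exact .of_map hφ ((h.iff_of_stellar fun _ _ h =>
    ⟨fun h' => h'.isStellarSubdivision h, fun h' => h'.of_isStellarSubdivision h⟩).mpr
      (isStronglyConnected_simplexBoundary d))

end

end CombSlicing

/-! ### Counting faces of combinatorial 3-manifolds -/

namespace CombSlicing

open Finset

section
variable {V : Type*} [Fintype V] [DecidableEq V]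

open Classical in
/-- The faces of `M` as a finite set. -/
noncomputable def faceFinset (M : AbstractSimplicialComplex V) : Finset (Finset V) :=
  {t | t ∈ M.faces}

omit [DecidableEq V] in
@[simp]
theorem mem_faceFinset {M : AbstractSimplicialComplex V} {t : Finset V} :
    t ∈ faceFinset M ↔ t ∈ M.faces := by
  simp [faceFinset]

/-- The faces of `M` with vertices both inside and outside `A`. -/
noncomputable def mixedFaces (M : AbstractSimplicialComplex V) (A : Finset V) :
    Finset (Finset V) :=
  {t ∈ faceFinset M | ¬ t ⊆ A ∧ ¬ Disjoint t A}

/-- Erasing a vertex `v` of `p` turns the faces around `p` into link faces around `p.erase v` and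
flips the signs, so `-1` becomes `1`. The case `p = {v}` is why Euler sums include the empty face.
-/
theorem IsCombManifold.sum_faces_containing {M : AbstractSimplicialComplex V}
    (hM : IsCombManifold 3 M) {p : Finset V} (hp : p ∈ M.faces) :
    ∑ t ∈ faceFinset M with p ⊆ t, (-1 : ℤ) ^ #t = 1 := by
  obtain ⟨v, hv⟩ := (M.isRelLowerSet_faces hp).1
  obtain ⟨F, hF, hE⟩ := (hM.2.2 v).hasEulerSums
  have hF' : ∀ s, s ∈ F ↔ v ∉ s ∧ insert v s ∈ M.faces := by
    intro s
    rw [hF]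
    change (s.Nonempty ∧ v ∉ s ∧ insert v s ∈ M.faces) ∨ s = ∅ ↔ _
    rcases s.eq_empty_or_nonempty with rfl | h
    · simp [M.singleton_mem v]
    · simp [h, h.ne_empty]
  have h := hE (p.erase v) ((hF' _).mpr ⟨Finset.notMem_erase _ _, by rwa [Finset.insert_erase hv]⟩)
  unfold eulerSum at h
  rw [← neg_inj, ← Finset.sum_neg_distrib]
  refine Eq.trans ?_ h
  symm
  refine Finset.sum_bij' (fun t _ => insert v t) (fun t _ => t.erase v) ?_ ?_ ?_ ?_ ?_
  · intro t ht
    rw [Finset.mem_filter, hF'] at ht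
    rw [Finset.mem_filter, mem_faceFinset]
    refine ⟨ht.1.2, ?_⟩
    rw [← Finset.insert_erase hv]
    exact Finset.insert_subset_insert _ ht.2
  · intro t ht
    rw [Finset.mem_filter, mem_faceFinset] at ht
    rw [Finset.mem_filter, hF']
    exact ⟨⟨Finset.notMem_erase _ _, by rw [Finset.insert_erase (ht.2 hv)]; exact ht.1⟩,
      Finset.erase_subset_erase _ ht.2⟩
  · intro t ht
    rw [Finset.mem_filter, hF'] at ht
    exact Finset.erase_insert ht.1.1
  · intro t ht
    rw [Finset.mem_filter] at ht
    exact Finset.insert_erase (ht.2 hv)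
  · intro t ht
    rw [Finset.mem_filter, hF'] at ht
    rw [Finset.card_insert_of_notMem ht.1.1, pow_succ]
    ring

/-- The Euler characteristic of a slicing is twice that of the full subcomplex on one side. -/
theorem IsCombManifold.sum_mixedFaces {M : AbstractSimplicialComplex V}
    (hM : IsCombManifold 3 M) (A : Finset V) :
    ∑ t ∈ mixedFaces M A, (-1 : ℤ) ^ #t = -2 * ∑ t ∈ faceFinset M with t ⊆ A, (-1 : ℤ) ^ #t := by
  -- After exchanging the sums, `t` carries the factor `∑ (-1) ^ #p` over nonempty `p ⊆ t ∩ A`,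
  -- which is `-1` as soon as `t` meets `A`.
  have hdouble : ∑ p ∈ faceFinset M with p ⊆ A, (-1 : ℤ) ^ #p *
      (∑ t ∈ faceFinset M with p ⊆ t, (-1 : ℤ) ^ #t) =
      - ∑ t ∈ faceFinset M with ¬ Disjoint t A, (-1 : ℤ) ^ #t := by
    simp only [Finset.mul_sum]
    rw [Finset.sum_comm' (s' := fun t => {p ∈ faceFinset M | p ⊆ A ∧ p ⊆ t})
      (t' := {t ∈ faceFinset M | ¬ Disjoint t A}), ← Finset.sum_neg_distrib]
    · refine Finset.sum_congr rfl fun t ht => ?_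
      rw [Finset.mem_filter, mem_faceFinset] at ht
      have hne : (t ∩ A).Nonempty := Finset.not_disjoint_iff_nonempty_inter.mp ht.2
      have h1 : ({p ∈ faceFinset M | p ⊆ A ∧ p ⊆ t}) = (t ∩ A).powerset.erase ∅ := by
        ext p
        rw [Finset.mem_filter, mem_faceFinset, Finset.mem_erase, Finset.mem_powerset,
          Finset.subset_inter_iff, ← Finset.nonempty_iff_ne_empty]
        constructor
        · rintro ⟨h1, h2, h3⟩
          exact ⟨(M.isRelLowerSet_faces h1).1, h3, h2⟩
        · rintro ⟨h1, h2, h3⟩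
          exact ⟨(M.isRelLowerSet_faces ht.1).2 h2 h1, h3, h2⟩
      have h2 := Finset.sum_powerset_neg_one_pow_card_of_nonempty hne
      rw [← Finset.add_sum_erase _ _ (Finset.empty_mem_powerset _)] at h2
      rw [← Finset.sum_mul, h1]
      have h3 : ∑ p ∈ (t ∩ A).powerset.erase ∅, (-1 : ℤ) ^ #p = -1 := by
        simp only [Finset.card_empty, pow_zero] at h2
        linarith
      rw [h3, neg_one_mul]
    · intro p t
      simp only [Finset.mem_filter, mem_faceFinset]
      constructor
      · rintro ⟨⟨h1, h2⟩, h3, h4⟩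
        refine ⟨⟨h1, h2, h4⟩, h3, ?_⟩
        obtain ⟨y, hy⟩ := (M.isRelLowerSet_faces h1).1
        exact Finset.not_disjoint_iff.mpr ⟨y, h4 hy, h2 hy⟩
      · tauto
  have h1 : ∑ p ∈ faceFinset M with p ⊆ A, (-1 : ℤ) ^ #p *
      (∑ t ∈ faceFinset M with p ⊆ t, (-1 : ℤ) ^ #t) =
      ∑ p ∈ faceFinset M with p ⊆ A, (-1 : ℤ) ^ #p := by
    refine Finset.sum_congr rfl fun p hp => ?_
    rw [Finset.mem_filter, mem_faceFinset] at hp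
    rw [hM.sum_faces_containing hp.1, mul_one]
  -- A face meeting `A` lies inside `A` or is mixed, so the sum over `A` equals minus itself minus
  -- the mixed sum.
  have h2 := Finset.sum_filter_add_sum_filter_not ({t ∈ faceFinset M | ¬ Disjoint t A})
    (fun t => t ⊆ A) (fun t => (-1 : ℤ) ^ #t)
  rw [Finset.filter_filter, Finset.filter_filter] at h2
  have e1 : (faceFinset M).filter (fun t => ¬ Disjoint t A ∧ t ⊆ A) =
      (faceFinset M).filter (fun t => t ⊆ A) := by
    refine Finset.filter_congr fun t ht => ⟨And.right, fun h => ⟨?_, h⟩⟩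
    obtain ⟨y, hy⟩ := (M.isRelLowerSet_faces (mem_faceFinset.mp ht)).1
    exact Finset.not_disjoint_iff.mpr ⟨y, hy, h hy⟩
  have e2 : (faceFinset M).filter (fun t => ¬ Disjoint t A ∧ ¬ t ⊆ A) = mixedFaces M A := by
    unfold mixedFaces
    exact Finset.filter_congr fun t ht => and_comm
  rw [e1, e2] at h2
  linarith

/-- The local Euler sum at a triangle is `-1` plus the number of tetrahedra containing it, and it
equals 1. -/
theorem IsCombManifold.card_tetrahedra_of_triangle {M : AbstractSimplicialComplex V}
    (hM : IsCombManifold 3 M) {p : Finset V} (hp : p ∈ M.faces) (hcp : #p = 3) :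
    #{t ∈ faceFinset M | #t = 4 ∧ p ⊆ t} = 2 := by
  have h := hM.sum_faces_containing hp
  have h1 : (faceFinset M).filter (fun t => p ⊆ t) =
      insert p ({t ∈ faceFinset M | #t = 4 ∧ p ⊆ t}) := by
    ext t
    simp only [Finset.mem_filter, Finset.mem_insert, mem_faceFinset]
    constructor
    · rintro ⟨h1, h2⟩
      have h3 := hM.1 t h1
      have h4 := Finset.card_le_card h2
      by_cases h5 : #t = 4
      · exact Or.inr ⟨h1, h5, h2⟩
      · exact Or.inl (Finset.eq_of_subset_of_card_le h2 (by omega)).symm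
    · rintro (rfl | ⟨h1, _, h2⟩)
      · exact ⟨hp, Finset.Subset.refl _⟩
      · exact ⟨h1, h2⟩
  rw [h1, Finset.sum_insert (by simp [hcp]), hcp,
    Finset.sum_congr rfl (g := fun _ => (1 : ℤ)) (fun t ht => by
      rw [(Finset.mem_filter.mp ht).2.1]; norm_num)] at h
  simp only [Finset.sum_const, nsmul_eq_mul, mul_one] at h
  have : ((#{t ∈ faceFinset M | #t = 4 ∧ p ⊆ t} : ℕ) : ℤ) = 2 := by
    linarith
  exact_mod_cast this

theorem IsCombManifold.exists_adjacent {M : AbstractSimplicialComplex V}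
    (hM : IsCombManifold 3 M) {t : Finset V} (ht : t ∈ M.faces) (hct : #t = 4) {y : V}
    (hy : y ∈ t) : ∃ u ∈ M.faces, #u = 4 ∧ t.erase y ⊆ u ∧ y ∉ u := by
  have h1 : #(t.erase y) = 3 := by rw [Finset.card_erase_of_mem hy, hct]
  have h2 : t.erase y ∈ M.faces := (M.isRelLowerSet_faces ht).2 (Finset.erase_subset _ _)
    (Finset.card_pos.mp (by omega))
  have h3 := hM.card_tetrahedra_of_triangle h2 h1
  obtain ⟨u, hu, hne⟩ := Finset.exists_mem_ne (by rw [h3]; norm_num) t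
  rw [Finset.mem_filter, mem_faceFinset] at hu
  obtain ⟨hu1, hu2, hu3⟩ := hu
  refine ⟨u, hu1, hu2, hu3, fun h => hne ?_⟩
  refine (Finset.eq_of_subset_of_card_le (fun z hz => ?_) (by omega)).symm
  by_cases hzy : z = y
  · exact hzy ▸ h
  · exact hu3 (Finset.mem_erase.mpr ⟨hzy, hz⟩)

/-- Take a tetrahedron `t = e ∪ {c, d}` and its neighbours `u`, `w` across the two triangles that
contain `e`. They differ from `t` and from each other: `u` misses `c` but contains `d`, and `w`
misses `d`. -/
theorem IsCombManifold.three_le_card_tetrahedra_of_edge {M : AbstractSimplicialComplex V}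
    (hM : IsCombManifold 3 M) {e : Finset V} (he : e ∈ M.faces) (hce : #e = 2) :
    3 ≤ #{t ∈ faceFinset M | #t = 4 ∧ e ⊆ t} := by
  obtain ⟨t, ht, het, hct⟩ := hM.2.1 e he
  obtain ⟨c, d, hcd, h1⟩ := Finset.card_eq_two.mp
    (show #(t \ e) = 2 by rw [Finset.card_sdiff_of_subset het]; omega)
  have hc : c ∈ t \ e := by simp [h1]
  have hd : d ∈ t \ e := by simp [h1]
  rw [Finset.mem_sdiff] at hc hd
  obtain ⟨u, hu, hcu, htu, hcu'⟩ := hM.exists_adjacent ht hct hc.1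
  obtain ⟨w, hw, hcw, htw, hdw⟩ := hM.exists_adjacent ht hct hd.1
  have heu : e ⊆ u := fun z hz => htu (Finset.mem_erase.mpr
    ⟨fun h => hc.2 (h ▸ hz), het hz⟩)
  have hew : e ⊆ w := fun z hz => htw (Finset.mem_erase.mpr
    ⟨fun h => hd.2 (h ▸ hz), het hz⟩)
  have hdu : d ∈ u := htu (Finset.mem_erase.mpr ⟨hcd.symm, hd.1⟩)
  rw [← Finset.card_eq_three.mpr ⟨t, u, w, fun h => hcu' (h ▸ hc.1), fun h => hdw (h ▸ hd.1),
    fun h => hdw (h ▸ hdu), rfl⟩]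
  refine Finset.card_le_card fun r hr => ?_
  simp only [Finset.mem_insert, Finset.mem_singleton] at hr
  rw [Finset.mem_filter, mem_faceFinset]
  rcases hr with rfl | rfl | rfl
  · exact ⟨ht, hct, het⟩
  · exact ⟨hu, hcu, heu⟩
  · exact ⟨hw, hcw, hew⟩

/-- If `A` spans `e` edges, the mixed sum is `2(#A - e)`, so the left side is `6e`; the claim is
twice the bound of three split tetrahedra per edge. -/
theorem IsCombManifold.three_mul_le_card_tetrahedra {M : AbstractSimplicialComplex V}
    (hM : IsCombManifold 3 M) {A : Finset V} (hA : ∀ t ∈ M.faces, t ⊆ A → #t ≤ 2) :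
    6 * (#A : ℤ) - 3 * ∑ t ∈ mixedFaces M A, (-1 : ℤ) ^ #t ≤
      2 * #{t ∈ faceFinset M | #t = 4 ∧ #(t ∩ A) = 2} := by
  have hsum : ∑ t ∈ faceFinset M with t ⊆ A, (-1 : ℤ) ^ #t =
      -#A + #{t ∈ faceFinset M | t ⊆ A ∧ #t = 2} := by
    rw [← Finset.sum_filter_add_sum_filter_not _ (fun t => #t = 2), Finset.filter_filter,
      Finset.filter_filter, add_comm]
    congr 1
    · have h1 : (faceFinset M).filter (fun t => t ⊆ A ∧ ¬ #t = 2) = A.image ({·}) := by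
        ext t
        simp only [Finset.mem_filter, mem_faceFinset, Finset.mem_image]
        constructor
        · rintro ⟨h1, h2, h3⟩
          have h4 := hA t h1 h2
          have h5 := (M.isRelLowerSet_faces h1).1.card_pos
          obtain ⟨y, rfl⟩ := Finset.card_eq_one.mp (show #t = 1 by omega)
          exact ⟨y, h2 (Finset.mem_singleton_self y), rfl⟩
        · rintro ⟨y, hy, rfl⟩
          exact ⟨M.singleton_mem y, Finset.singleton_subset_iff.mpr hy, by simp⟩
      rw [h1, Finset.sum_image (fun _ _ _ _ h => Finset.singleton_injective h)]
      simp
    · rw [Finset.sum_congr rfl (g := fun _ => (1 : ℤ)) (fun t ht => by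
        rw [(Finset.mem_filter.mp ht).2.2]; norm_num)]
      simp
  -- Split tetrahedra are grouped by the edge `t ∩ A`. Every tetrahedron containing `e` is in the
  -- group of `e`, since a third vertex in `A` would give a face of three vertices inside `A`.
  have hfib : 3 * #{t ∈ faceFinset M | t ⊆ A ∧ #t = 2} ≤
      #{t ∈ faceFinset M | #t = 4 ∧ #(t ∩ A) = 2} := by
    rw [Finset.card_eq_sum_card_fiberwise
      (s := {t ∈ faceFinset M | #t = 4 ∧ #(t ∩ A) = 2}) (f := fun t => t ∩ A)
      (t := {t ∈ faceFinset M | t ⊆ A ∧ #t = 2}), mul_comm, ← smul_eq_mul]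
    · refine Finset.card_nsmul_le_sum _ _ _ fun e he => ?_
      rw [Finset.mem_filter, mem_faceFinset] at he
      refine (hM.three_le_card_tetrahedra_of_edge he.1 he.2.2).trans (Finset.card_le_card ?_)
      intro t ht
      simp only [Finset.mem_filter, mem_faceFinset] at ht ⊢
      have h1 : t ∩ A = e := by
        symm
        have h2 := Finset.subset_inter ht.2.2 he.2.1
        refine Finset.eq_of_subset_of_card_le h2 ?_
        rw [he.2.2]
        refine hA _ ((M.isRelLowerSet_faces ht.1).2 Finset.inter_subset_left ?_)
          Finset.inter_subset_right
        exact (M.isRelLowerSet_faces he.1).1.mono h2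
      exact ⟨⟨ht.1, ht.2.1, by rw [h1, he.2.2]⟩, h1⟩
    · intro t ht
      simp only [Finset.coe_filter, Set.mem_ofPred_eq, mem_faceFinset] at ht ⊢
      refine ⟨(M.isRelLowerSet_faces ht.1).2 Finset.inter_subset_left ?_,
        Finset.inter_subset_right, ht.2.2⟩
      exact Finset.card_pos.mp (by omega)
  rw [hM.sum_mixedFaces, hsum]
  omega

end

end CombSlicing

/-! ### Connected manifolds are strongly connected -/

namespace CombSlicing

open Finset

section
variable {V : Type*} [Fintype V] [DecidableEq V]

omit [Fintype V] in
-- Facets at `v` are cones over facets of the link, which is strongly connected, and coning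
-- preserves adjacency.
theorem IsCombManifold.adjacency_class_at_vertex {M : AbstractSimplicialComplex V} {d : ℕ}
    (hM : IsCombManifold d M) {c : Finset V → Prop}
    (hc : RespectsAdjacency (d + 1) M.toPreAbstractSimplicialComplex c) {v : V} {t u : Finset V}
    (ht : t ∈ M.faces) (hu : u ∈ M.faces) (hct : #t = d + 1) (hcu : #u = d + 1) (hvt : v ∈ t)
    (hvu : v ∈ u) : c t ↔ c u := by
  -- For `d = 0` erasing `v` leaves the empty set, which is not a face of the link, but both facets
  -- are then `{v}`.
  rcases Nat.eq_zero_or_pos d with rfl | hd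
  · obtain ⟨y, rfl⟩ := Finset.card_eq_one.mp hct
    obtain ⟨z, rfl⟩ := Finset.card_eq_one.mp hcu
    rw [Finset.mem_singleton] at hvt hvu
    rw [← hvt, ← hvu]
  have hlink : ∀ r ∈ M.faces, #r = d + 1 → v ∈ r →
      r.erase v ∈ (link M.toPreAbstractSimplicialComplex v).faces ∧ #(r.erase v) = d := by
    intro r hr hcr hvr
    have h1 := Finset.card_erase_add_one hvr
    exact ⟨⟨Finset.card_pos.mp (by omega), Finset.notMem_erase _ _,
      by rwa [Finset.insert_erase hvr]⟩, by omega⟩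
  have h := (hM.2.2 v).isStronglyConnected.2 (fun s => c (insert v s)) ?_
    _ (hlink t ht hct hvt).1 _ (hlink u hu hcu hvu).1 (hlink t ht hct hvt).2 (hlink u hu hcu hvu).2
  · simpa only [Finset.insert_erase hvt, Finset.insert_erase hvu] using h
  · rintro r ⟨_, hr, hr'⟩ q ⟨_, hq, hq'⟩ hcr hcq hrq
    refine hc _ hr' _ hq' ?_ ?_ ?_
    · rw [Finset.card_insert_of_notMem hr, hcr]
    · rw [Finset.card_insert_of_notMem hq, hcq]
    · rw [← Finset.insert_inter_distrib, Finset.card_insert_of_notMem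
        (fun h => hr (Finset.mem_inter.mp h).1)]
      omega

theorem vertexPoint_mem_closedSimplex {v : V} {s : Finset V} (hv : v ∈ s) :
    vertexPoint v ∈ closedSimplex s :=
  ⟨single_mem_stdSimplex ℝ v, fun w hw => Pi.single_eq_of_ne (fun h => hw (by rwa [h])) 1⟩

/-- The sum of the barycentric coordinates over `B` is continuous, and takes only the values 0 and 1
when no face straddles `B`; on a connected set it cannot take both. -/
theorem eq_univ_or_empty_of_isConnected {M : AbstractSimplicialComplex V}
    (hM : IsConnected (realization M)) {B : Finset V}
    (hB : ∀ s ∈ M.faces, s ⊆ B ∨ Disjoint s B) : (∀ v, v ∈ B) ∨ ∀ v, v ∉ B := by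
  by_contra! h
  obtain ⟨⟨a, ha⟩, b, hb⟩ := h
  have hmem : ∀ v : V, vertexPoint v ∈ realization M := fun v =>
    Set.mem_biUnion (M.singleton_mem v) (vertexPoint_mem_closedSimplex (by simp))
  have hcont : Continuous fun p : V → ℝ => ∑ v ∈ B, p v := by fun_prop
  have hord := (hM.isPreconnected.image _ hcont.continuousOn).ordConnected
  have h0 : (0 : ℝ) ∈ (fun p : V → ℝ => ∑ v ∈ B, p v) '' realization M :=
    ⟨_, hmem a, by simp [vertexPoint, Pi.single_apply, ha]⟩
  have h1 : (1 : ℝ) ∈ (fun p : V → ℝ => ∑ v ∈ B, p v) '' realization M :=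
    ⟨_, hmem b, by simp [vertexPoint, Pi.single_apply, hb]⟩
  obtain ⟨p, hp, hp2⟩ := hord.out h0 h1 (show (1 / 2 : ℝ) ∈ Set.Icc 0 1 by norm_num)
  obtain ⟨s, hs, hp⟩ := Set.mem_iUnion₂.mp hp
  simp only at hp2
  rcases hB s hs with hsB | hsB
  · have : ∑ v ∈ B, p v = 1 := by
      rw [← hp.1.2]
      exact Finset.sum_subset (Finset.subset_univ _) fun v _ hv => hp.2 v fun h => hv (hsB h)
    norm_num [this] at hp2
  · have : ∑ v ∈ B, p v = 0 :=
      Finset.sum_eq_zero fun v hv => hp.2 v fun h => Finset.disjoint_left.mp hsB h hv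
    norm_num [this] at hp2

/-- All facets at a vertex have the same colour, so colours descend to vertices. By purity no face
has vertices of both colours, and connectedness leaves only one. -/
theorem IsCombManifold.adjacency_class {M : AbstractSimplicialComplex V} {d : ℕ}
    (hM : IsCombManifold d M) (hconn : IsConnected (realization M)) {c : Finset V → Prop}
    (hc : RespectsAdjacency (d + 1) M.toPreAbstractSimplicialComplex c) {t u : Finset V}
    (ht : t ∈ M.faces) (hu : u ∈ M.faces) (hct : #t = d + 1) (hcu : #u = d + 1) :
    c t ↔ c u := by
  classical
  let B : Finset V := {v | ∃ t ∈ M.faces, #t = d + 1 ∧ v ∈ t ∧ c t}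
  have hBmem : ∀ t ∈ M.faces, #t = d + 1 → ∀ v ∈ t, (v ∈ B ↔ c t) := by
    intro t ht hct v hv
    simp only [B, Finset.mem_filter, Finset.mem_univ, true_and]
    constructor
    · rintro ⟨u, hu, hcu, hvu, h⟩
      exact (hM.adjacency_class_at_vertex hc ht hu hct hcu hv hvu).mpr h
    · exact fun h => ⟨t, ht, hct, hv, h⟩
  obtain ⟨y, hy⟩ := (M.isRelLowerSet_faces ht).1
  obtain ⟨z, hz⟩ := (M.isRelLowerSet_faces hu).1
  rw [← hBmem t ht hct y hy, ← hBmem u hu hcu z hz]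
  have hB : ∀ s ∈ M.faces, s ⊆ B ∨ Disjoint s B := by
    intro s hs
    obtain ⟨r, hr, hsr, hcr⟩ := hM.2.1 s hs
    by_cases h : c r
    · exact Or.inl fun v hv => (hBmem r hr hcr v (hsr hv)).mpr h
    · exact Or.inr (Finset.disjoint_left.mpr fun v hv hvB =>
        h ((hBmem r hr hcr v (hsr hv)).mp hvB))
  rcases eq_univ_or_empty_of_isConnected hconn hB with h | h <;> simp [h]

theorem mem_mixedFaces {M : AbstractSimplicialComplex V} {A t : Finset V} :
    t ∈ mixedFaces M A ↔ t ∈ M.faces ∧ ¬ t ⊆ A ∧ ¬ Disjoint t A := by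
  simp [mixedFaces]

theorem mixedFaces_compl (M : AbstractSimplicialComplex V) (A : Finset V) :
    mixedFaces M Aᶜ = mixedFaces M A := by
  ext t
  rw [mem_mixedFaces, mem_mixedFaces, Finset.subset_compl_iff_disjoint_right,
    disjoint_compl_right_iff]
  tauto

theorem card_inter_compl_add (A t : Finset V) : #(t ∩ Aᶜ) + #(t ∩ A) = #t := by
  rw [← Finset.sdiff_eq_inter_compl, Finset.card_sdiff_add_card_inter]

theorem IsCombManifold.hasDim_inducedSpan {M : AbstractSimplicialComplex V}
    (hM : IsCombManifold 3 M) (hconn : IsConnected (realization M)) {A : Finset V}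
    (hne : (mixedFaces M A).Nonempty)
    (hA : ∀ t ∈ mixedFaces M A, #t = 4 → #(t ∩ A) = 2) :
    HasDim (inducedSpan M.toPreAbstractSimplicialComplex A) 1 := by
  obtain ⟨s, hs⟩ := hne
  rw [mem_mixedFaces] at hs
  obtain ⟨t, ht, hst, hct⟩ := hM.2.1 s hs.1
  have htA : ¬ t ⊆ A := fun h => hs.2.1 (hst.trans h)
  have ht2 : #(t ∩ A) = 2 :=
    hA t (mem_mixedFaces.mpr ⟨ht, htA, fun h => hs.2.2 (h.mono_left hst)⟩) hct
  have hthree : ∀ u ∈ M.faces, #u = 4 → 3 ≤ #(u ∩ A) → u ⊆ A := by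
    intro u hu hcu h
    by_contra hn
    have h1 : u ∈ mixedFaces M A := mem_mixedFaces.mpr ⟨hu, hn,
      Finset.not_disjoint_iff_nonempty_inter.mpr (Finset.card_pos.mp (by omega))⟩
    have := hA u h1 hcu
    omega
  -- A neighbour of a tetrahedron inside `A` has at least three vertices in `A`, hence all four.
  have hresp : RespectsAdjacency 4 M.toPreAbstractSimplicialComplex (fun u => u ⊆ A) := by
    have : ∀ u ∈ M.faces, ∀ w ∈ M.faces, #w = 4 → 4 ≤ #(u ∩ w) + 1 → u ⊆ A → w ⊆ A := by
      intro u _ w hw hcw huw h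
      refine hthree w hw hcw ?_
      have : u ∩ w ⊆ w ∩ A := fun z hz =>
        Finset.mem_inter.mpr ⟨(Finset.mem_inter.mp hz).2, h (Finset.mem_inter.mp hz).1⟩
      have := Finset.card_le_card this
      omega
    exact fun u hu w hw hcu hcw huw => ⟨this u hu w hw hcw huw,
      this w hw u hu hcu (by rwa [Finset.inter_comm])⟩
  refine ⟨⟨t ∩ A, ⟨(M.isRelLowerSet_faces ht).2 Finset.inter_subset_left
    (Finset.card_pos.mp (by omega)), Finset.inter_subset_right⟩, ht2⟩, ?_⟩
  rintro r ⟨hr, hrA⟩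
  by_contra! h
  obtain ⟨u, hu, hru, hcu⟩ := hM.2.1 r hr
  have h1 := Finset.card_le_card (Finset.subset_inter hru hrA)
  exact htA ((hM.adjacency_class hconn hresp ht hu hct hcu).mpr (hthree u hu hcu (by omega)))

end

end CombSlicing

/-! ### The cells of a slicing -/

namespace CombSlicing

open Finset

section
variable {V : Type*} [Fintype V]

/-- The intersection of the closed simplex `s` with the level `x` of the linear function that
takes the values `h` at the vertices. -/
def levelCell (h : V → ℝ) (x : ℝ) (s : Finset V) : Set (V → ℝ) :=
  {p | p ∈ closedSimplex s ∧ ∑ v, p v * h v = x}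

/-- The directions tangent to `levelCell h x s`. -/
def levelDirection (h : V → ℝ) (s : Finset V) : Submodule ℝ (V → ℝ) where
  carrier := {u | (∀ v ∉ s, u v = 0) ∧ ∑ v, u v = 0 ∧ ∑ v, u v * h v = 0}
  add_mem' := by
    rintro u w ⟨h1, h2, h3⟩ ⟨k1, k2, k3⟩
    refine ⟨fun v hv => ?_, ?_, ?_⟩
    · rw [Pi.add_apply, h1 v hv, k1 v hv, add_zero]
    · simp only [Pi.add_apply, Finset.sum_add_distrib, h2, k2, add_zero]
    · simp only [Pi.add_apply, add_mul, Finset.sum_add_distrib, h3, k3, add_zero]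
  zero_mem' := by simp
  smul_mem' := by
    rintro r u ⟨h1, h2, h3⟩
    refine ⟨fun v hv => ?_, ?_, ?_⟩
    · rw [Pi.smul_apply, h1 v hv, smul_zero]
    · simp only [Pi.smul_apply, smul_eq_mul, ← Finset.mul_sum, h2, mul_zero]
    · simp only [Pi.smul_apply, smul_eq_mul, mul_assoc, ← Finset.mul_sum, h3, mul_zero]

variable {h : V → ℝ} {x : ℝ} {s : Finset V}

theorem mem_levelDirection {u : V → ℝ} : u ∈ levelDirection h s ↔
    (∀ v ∉ s, u v = 0) ∧ ∑ v, u v = 0 ∧ ∑ v, u v * h v = 0 := Iff.rfl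

theorem mem_levelCell {p : V → ℝ} : p ∈ levelCell h x s ↔
    (∀ v, 0 ≤ p v) ∧ ∑ v, p v = 1 ∧ (∀ v ∉ s, p v = 0) ∧ ∑ v, p v * h v = x := by
  simp only [levelCell, closedSimplex, stdSimplex, Set.mem_ofPred_eq, and_assoc]

theorem convex_levelCell : Convex ℝ (levelCell h x s) := by
  intro p hp q hq a b ha hb hab
  rw [mem_levelCell] at hp hq ⊢
  obtain ⟨p1, p2, p3, p4⟩ := hp
  obtain ⟨q1, q2, q3, q4⟩ := hq
  simp only [Pi.add_apply, Pi.smul_apply, smul_eq_mul]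
  refine ⟨fun v => add_nonneg (mul_nonneg ha (p1 v)) (mul_nonneg hb (q1 v)), ?_, ?_, ?_⟩
  · rw [Finset.sum_add_distrib, ← Finset.mul_sum, ← Finset.mul_sum, p2, q2]
    linarith
  · intro v hv
    rw [p3 v hv, q3 v hv]
    ring
  · simp only [add_mul, mul_assoc]
    rw [Finset.sum_add_distrib, ← Finset.mul_sum, ← Finset.mul_sum, p4, q4, ← add_mul, hab,
      one_mul]

/-- On `ℝ^s` the functionals `∑ w v` and `∑ w v * h v` are independent because `h` is not constant
on `s`, so their common kernel has codimension two. -/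
theorem finrank_levelDirection [DecidableEq V] {a b : V} (ha : a ∈ s) (hb : b ∈ s)
    (hab : h a ≠ h b) : Module.finrank ℝ (levelDirection h s) + 2 = #s := by
  let T : (s → ℝ) →ₗ[ℝ] ℝ × ℝ :=
    LinearMap.prod (∑ v : s, LinearMap.proj v) (∑ v : s, h v • LinearMap.proj v)
  have hT : ∀ w : s → ℝ, T w = (∑ v, w v, ∑ v : s, w v * h v) := by
    intro w
    simp [T, mul_comm]
  have hsurj : Function.Surjective T := by
    rintro ⟨y, z⟩
    have hne : h b - h a ≠ 0 := sub_ne_zero.mpr hab.symm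
    -- The coefficients at `a` and `b` solve `α + β = y`, `α * h a + β * h b = z`.
    refine ⟨Pi.single ⟨a, ha⟩ (y - (z - y * h a) / (h b - h a)) +
      Pi.single ⟨b, hb⟩ ((z - y * h a) / (h b - h a)), ?_⟩
    rw [hT]
    simp only [Pi.add_apply, add_mul, Finset.sum_add_distrib, Pi.single_apply, ite_mul, zero_mul,
      Finset.sum_ite_eq', Finset.mem_univ, if_true, Prod.mk.injEq]
    constructor
    · ring
    · field_simp
      ring
  let ext : (s → ℝ) →ₗ[ℝ] V → ℝ := Function.ExtendByZero.linearMap ℝ (Subtype.val : s → V)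
  have hext : ∀ (w : s → ℝ) (v : s), ext w v = w v := fun w v =>
    Subtype.val_injective.extend_apply w (0 : V → ℝ) v
  have hext0 : ∀ (w : s → ℝ), ∀ v ∉ s, ext w v = 0 := fun w v hv =>
    Function.extend_apply' w (0 : V → ℝ) v fun ⟨z, hz⟩ => hv (hz ▸ z.2)
  have hinj : Function.Injective ext := by
    intro w z hwz
    funext v
    rw [← hext w, ← hext z, hwz]
  have hsum : ∀ u : V → ℝ, (∀ v ∉ s, u v = 0) → ∑ v, u v = ∑ v : s, u v := by
    intro u hu
    rw [Finset.sum_coe_sort s]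
    exact (Finset.sum_subset (Finset.subset_univ s) fun v _ hv => hu v hv).symm
  have hmap : (LinearMap.ker T).map ext = levelDirection h s := by
    ext u
    rw [Submodule.mem_map, mem_levelDirection]
    constructor
    · rintro ⟨w, hw, rfl⟩
      rw [LinearMap.mem_ker, hT, Prod.mk_eq_zero] at hw
      refine ⟨hext0 w, ?_, ?_⟩
      · rw [hsum _ (hext0 w)]
        simpa only [hext] using hw.1
      · rw [hsum (fun v => ext w v * h v) fun v hv => by rw [hext0 w v hv, zero_mul]]
        simpa only [hext] using hw.2
    · rintro ⟨h1, h2, h3⟩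
      refine ⟨fun v => u v, ?_, ?_⟩
      · rw [LinearMap.mem_ker, hT, Prod.mk_eq_zero]
        rw [hsum u h1] at h2
        rw [hsum (fun v => u v * h v) fun v hv => by rw [h1 v hv, zero_mul]] at h3
        exact ⟨h2, h3⟩
      · funext v
        by_cases hv : v ∈ s
        · exact hext _ ⟨v, hv⟩
        · rw [hext0 _ v hv, h1 v hv]
  have h1 := LinearMap.finrank_range_add_finrank_ker T
  rw [LinearMap.range_eq_top.mpr hsurj, finrank_top, Module.finrank_prod, Module.finrank_self,
    Module.finrank_fintype_fun_eq_card, Fintype.card_coe] at h1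
  rw [← hmap, ← (Submodule.equivMapOfInjective ext hinj (LinearMap.ker T)).finrank_eq]
  omega

/-- Positivity on `s` consists of finitely many strict inequalities, which survive a small move both
ways. This yields both the dimension of a cell and its extreme points. -/
theorem exists_perturbation {p u : V → ℝ} (hp : p ∈ levelCell h x s) (hpos : ∀ v ∈ s, 0 < p v)
    (hu : u ∈ levelDirection h s) :
    ∃ e : ℝ, 0 < e ∧ p + e • u ∈ levelCell h x s ∧ p - e • u ∈ levelCell h x s := by
  have hev : ∀ᶠ e in nhdsWithin (0 : ℝ) (Set.Ioi 0), ∀ v ∈ s, e * |u v| < p v := by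
    rw [Filter.eventually_all_finset]
    intro v hv
    refine Filter.Eventually.filter_mono nhdsWithin_le_nhds ?_
    have : Filter.Tendsto (fun e : ℝ => e * |u v|) (nhds 0) (nhds (0 * |u v|)) :=
      (continuous_id.mul continuous_const).tendsto 0
    rw [zero_mul] at this
    exact this.eventually_lt_const (hpos v hv)
  obtain ⟨e, he, he0⟩ := (hev.and self_mem_nhdsWithin).exists
  rw [mem_levelCell] at hp
  obtain ⟨p1, p2, p3, p4⟩ := hp
  obtain ⟨u1, u2, u3⟩ := mem_levelDirection.mp hu
  have key : ∀ r : ℝ, |r| = e → p + r • u ∈ levelCell h x s := by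
    intro r hr
    rw [mem_levelCell]
    simp only [Pi.add_apply, Pi.smul_apply, smul_eq_mul]
    refine ⟨fun v => ?_, ?_, ?_, ?_⟩
    · by_cases hv : v ∈ s
      · have h1 := he v hv
        rw [← hr, ← abs_mul] at h1
        linarith [neg_abs_le (r * u v)]
      · rw [u1 v hv, mul_zero, add_zero]
        exact p1 v
    · rw [Finset.sum_add_distrib, ← Finset.mul_sum, p2, u2, mul_zero, add_zero]
    · intro v hv
      rw [p3 v hv, u1 v hv, mul_zero, add_zero]
    · simp only [add_mul, mul_assoc]
      rw [Finset.sum_add_distrib, ← Finset.mul_sum, p4, u3, mul_zero, add_zero]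
  have he0' : (0 : ℝ) < e := he0
  refine ⟨e, he0', key e (abs_of_pos he0'), ?_⟩
  have := key (-e) (by rw [abs_neg, abs_of_pos he0'])
  rwa [neg_smul, ← sub_eq_add_neg] at this

theorem vectorSpan_levelCell {p : V → ℝ} (hp : p ∈ levelCell h x s)
    (hpos : ∀ v ∈ s, 0 < p v) : vectorSpan ℝ (levelCell h x s) = levelDirection h s := by
  apply le_antisymm
  · refine Submodule.span_le.mpr ?_
    rintro _ ⟨q, hq, r, hr, rfl⟩
    obtain ⟨_, q2, q3, q4⟩ := mem_levelCell.mp hq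
    obtain ⟨_, r2, r3, r4⟩ := mem_levelCell.mp hr
    simp only [vsub_eq_sub, SetLike.mem_coe]
    rw [mem_levelDirection]
    simp only [Pi.sub_apply, sub_mul, Finset.sum_sub_distrib, q2, r2, q4, r4, sub_self, and_true]
    intro v hv
    rw [q3 v hv, r3 v hv, sub_self]
  · intro u hu
    obtain ⟨e, he, h1, _⟩ := exists_perturbation hp hpos hu
    have h2 := vsub_mem_vectorSpan ℝ h1 hp
    rw [vsub_eq_sub, add_sub_cancel_left] at h2
    exact (Submodule.smul_mem_iff _ he.ne').mp h2

/-- The mean of `h v - x` with weights `p v` is zero, and its terms of positive weight are nonzero,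
so both signs occur. -/
theorem exists_lt_of_mem_levelCell (hx : ∀ v, h v ≠ x) {p : V → ℝ} (hp : p ∈ levelCell h x s) :
    (∃ a ∈ s, h a < x ∧ 0 < p a) ∧ ∃ b ∈ s, x < h b ∧ 0 < p b := by
  obtain ⟨p1, p2, p3, p4⟩ := mem_levelCell.mp hp
  have h0 : ∑ v, p v * (h v - x) = 0 := by
    simp only [mul_sub, Finset.sum_sub_distrib, ← Finset.sum_mul, p2, p4, one_mul, sub_self]
  have hex : ∃ v, 0 < p v := by
    by_contra! hn
    have : ∑ v, p v ≤ 0 := Finset.sum_nonpos fun v _ => hn v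
    linarith
  obtain ⟨w, hw⟩ := hex
  have hs : ∀ v, 0 < p v → v ∈ s := fun v hv => by
    by_contra hn
    exact hv.ne' (p3 v hn)
  constructor
  · by_contra! hn
    have h1 : ∀ v, 0 ≤ p v * (h v - x) := by
      intro v
      rcases (p1 v).lt_or_eq with hv | hv
      · refine mul_nonneg hv.le (sub_nonneg.mpr ?_)
        by_contra! hlt
        exact absurd hv (not_lt.mpr (hn v (hs v hv) hlt))
      · rw [← hv, zero_mul]
    have h2 := (Finset.sum_eq_zero_iff_of_nonneg fun v _ => h1 v).mp h0 w (Finset.mem_univ w)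
    exact mul_ne_zero hw.ne' (sub_ne_zero.mpr (hx w)) h2
  · by_contra! hn
    have h1 : ∀ v, p v * (h v - x) ≤ 0 := by
      intro v
      rcases (p1 v).lt_or_eq with hv | hv
      · refine mul_nonpos_of_nonneg_of_nonpos hv.le (sub_nonpos.mpr ?_)
        by_contra! hlt
        exact absurd hv (not_lt.mpr (hn v (hs v hv) hlt))
      · rw [← hv, zero_mul]
    have h2 := (Finset.sum_eq_zero_iff_of_nonpos fun v _ => h1 v).mp h0 w (Finset.mem_univ w)
    exact mul_ne_zero hw.ne' (sub_ne_zero.mpr (hx w)) h2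

/-! ### Vertices of a cell: the points where edges cross the level -/

variable [DecidableEq V]

/-- The point at level `x` on the segment between the vertices `e.1` and `e.2`. -/
noncomputable def edgePoint (h : V → ℝ) (x : ℝ) (e : V × V) : V → ℝ :=
  Pi.single e.1 ((h e.2 - x) / (h e.2 - h e.1)) + Pi.single e.2 ((x - h e.1) / (h e.2 - h e.1))

omit [Fintype V] in
theorem edgePoint_fst_pos {a b : V} (ha : h a < x) (hb : x < h b) :
    0 < edgePoint h x (a, b) a := by
  have hab : a ≠ b := fun e => absurd (ha.trans hb) (by rw [e]; exact lt_irrefl _)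
  simp only [edgePoint, Pi.add_apply, Pi.single_eq_same, Pi.single_eq_of_ne hab, add_zero]
  exact div_pos (by linarith) (by linarith)

omit [Fintype V] in
theorem edgePoint_snd_pos {a b : V} (ha : h a < x) (hb : x < h b) :
    0 < edgePoint h x (a, b) b := by
  have hab : b ≠ a := fun e => absurd (ha.trans hb) (by rw [e]; exact lt_irrefl _)
  simp only [edgePoint, Pi.add_apply, Pi.single_eq_same, Pi.single_eq_of_ne hab, zero_add]
  exact div_pos (by linarith) (by linarith)

omit [Fintype V] in
theorem edgePoint_of_ne {a b v : V} (ha : v ≠ a) (hb : v ≠ b) : edgePoint h x (a, b) v = 0 := by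
  simp [edgePoint, ha, hb]

theorem edgePoint_mem {a b : V} (ha : a ∈ s) (hb : b ∈ s) (hax : h a < x) (hxb : x < h b) :
    edgePoint h x (a, b) ∈ levelCell h x s := by
  have hne : h b - h a ≠ 0 := by linarith
  rw [mem_levelCell]
  refine ⟨fun v => ?_, ?_, ?_, ?_⟩
  · by_cases h1 : v = a
    · exact h1 ▸ (edgePoint_fst_pos hax hxb).le
    · by_cases h2 : v = b
      · exact h2 ▸ (edgePoint_snd_pos hax hxb).le
      · rw [edgePoint_of_ne h1 h2]
  · simp only [edgePoint, Pi.add_apply, Finset.sum_add_distrib, Pi.single_apply,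
      Finset.sum_ite_eq', Finset.mem_univ, if_true]
    field_simp
    ring
  · intro v hv
    exact edgePoint_of_ne (fun e => hv (e ▸ ha)) (fun e => hv (e ▸ hb))
  · simp only [edgePoint, Pi.add_apply, add_mul, Finset.sum_add_distrib, Pi.single_apply, ite_mul,
      zero_mul, Finset.sum_ite_eq', Finset.mem_univ, if_true]
    field_simp
    ring

theorem eq_edgePoint {a b : V} (hax : h a < x) (hxb : x < h b) {p : V → ℝ}
    (hp : p ∈ levelCell h x {a, b}) : p = edgePoint h x (a, b) := by
  have hab : a ≠ b := fun e => absurd (hax.trans hxb) (by rw [e]; exact lt_irrefl _)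
  have hne : h b - h a ≠ 0 := by linarith
  obtain ⟨_, p2, p3, p4⟩ := mem_levelCell.mp hp
  have hsum : ∀ g : V → ℝ, (∀ v ∉ ({a, b} : Finset V), g v = 0) → ∑ v, g v = g a + g b := by
    intro g hg
    rw [← Finset.sum_pair hab]
    exact (Finset.sum_subset (Finset.subset_univ _) fun v _ hv => hg v hv).symm
  rw [hsum p p3] at p2
  rw [hsum (fun v => p v * h v) fun v hv => by rw [p3 v hv, zero_mul]] at p4
  have e1 : p a = (h b - x) / (h b - h a) := by
    rw [eq_div_iff hne, ← p4]
    linear_combination h b * p2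
  have e2 : p b = (x - h a) / (h b - h a) := by
    rw [eq_div_iff hne, ← p4]
    linear_combination -h a * p2
  funext v
  by_cases h1 : v = a
  · subst h1
    simp [edgePoint, hab, e1]
  · by_cases h2 : v = b
    · subst h2
      simp [edgePoint, hab.symm, e2]
    · rw [edgePoint_of_ne h1 h2]
      exact p3 v (by simp [h1, h2])

/-- Each vertex of `s` is an end of an edge crossing the level, the other end being `a` or `b`; the
average of the crossing points is positive on all of `s`. -/
theorem exists_pos_mem_levelCell (hx : ∀ v, h v ≠ x) {a b : V} (ha : a ∈ s) (hb : b ∈ s)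
    (hax : h a < x) (hxb : x < h b) : ∃ p ∈ levelCell h x s, ∀ v ∈ s, 0 < p v := by
  have hex : ∀ v ∈ s, ∃ q ∈ levelCell h x s, 0 < q v := by
    intro v hv
    rcases lt_or_gt_of_ne (hx v) with hvx | hvx
    · exact ⟨_, edgePoint_mem hv hb hvx hxb, edgePoint_fst_pos hvx hxb⟩
    · exact ⟨_, edgePoint_mem ha hv hax hvx, edgePoint_snd_pos hax hvx⟩
  choose! q hq hqpos using hex
  have hcard : (0 : ℝ) < #s := by exact_mod_cast Finset.card_pos.mpr ⟨a, ha⟩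
  refine ⟨∑ v ∈ s, (#s : ℝ)⁻¹ • q v, convex_levelCell.sum_mem (fun v _ => by positivity) ?_ hq,
    fun v hv => ?_⟩
  · rw [Finset.sum_const, nsmul_eq_mul, mul_inv_cancel₀ hcard.ne']
  · rw [Finset.sum_apply]
    refine Finset.sum_pos' (fun w hw => ?_) ⟨v, hv, ?_⟩
    · exact mul_nonneg (by positivity) ((mem_levelCell.mp (hq w hw)).1 v)
    · exact mul_pos (by positivity) (hqpos v hv)

theorem levelCell_nonempty_iff (hx : ∀ v, h v ≠ x) :
    (levelCell h x s).Nonempty ↔ (∃ a ∈ s, h a < x) ∧ ∃ b ∈ s, x < h b := by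
  constructor
  · rintro ⟨p, hp⟩
    obtain ⟨⟨a, h1, h2, _⟩, b, h3, h4, _⟩ := exists_lt_of_mem_levelCell hx hp
    exact ⟨⟨a, h1, h2⟩, b, h3, h4⟩
  · rintro ⟨⟨a, h1, h2⟩, b, h3, h4⟩
    exact ⟨_, edgePoint_mem h1 h3 h2 h4⟩

theorem cellDim_levelCell (hx : ∀ v, h v ≠ x) (hne : (levelCell h x s).Nonempty) :
    cellDim (levelCell h x s) + 2 = #s := by
  obtain ⟨⟨a, h1, h2⟩, b, h3, h4⟩ := (levelCell_nonempty_iff hx).mp hne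
  obtain ⟨p, hp, hpos⟩ := exists_pos_mem_levelCell hx h1 h3 h2 h4
  unfold cellDim
  rw [vectorSpan_levelCell hp hpos]
  exact finrank_levelDirection h1 h3 (h2.trans h4).ne

theorem subset_of_levelCell_subset (hx : ∀ v, h v ≠ x) {t : Finset V}
    (hne : (levelCell h x s).Nonempty) (hst : levelCell h x s ⊆ levelCell h x t) : s ⊆ t := by
  obtain ⟨⟨a, h1, h2⟩, b, h3, h4⟩ := (levelCell_nonempty_iff hx).mp hne
  obtain ⟨p, hp, hpos⟩ := exists_pos_mem_levelCell hx h1 h3 h2 h4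
  intro v hv
  by_contra hn
  exact (hpos v hv).ne' ((mem_levelCell.mp (hst hp)).2.2.1 v hn)

/-- An extreme point has no tangent direction within its support, so by the dimension count the
support is a pair of vertices on opposite sides of the level. Conversely, if a crossing point is a
proper convex combination, the parts are supported on the same edge, which meets the level only
once. -/
theorem extremePoints_levelCell (hx : ∀ v, h v ≠ x) :
    (levelCell h x s).extremePoints ℝ =
      edgePoint h x '' (({v ∈ s | h v < x} ×ˢ {v ∈ s | x < h v} : Finset (V × V)) : Set (V × V)) := by
  ext p
  rw [mem_extremePoints_iff_left]
  constructor
  · rintro ⟨hp, hext⟩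
    -- `r` is the support of `p`, the smallest face of the simplex containing it.
    let r : Finset V := {v ∈ s | 0 < p v}
    obtain ⟨p1, p2, p3, p4⟩ := mem_levelCell.mp hp
    have hrs : r ⊆ s := Finset.filter_subset _ _
    have hpr : p ∈ levelCell h x r := by
      refine mem_levelCell.mpr ⟨p1, p2, fun v hv => ?_, p4⟩
      by_cases hvs : v ∈ s
      · refine le_antisymm (not_lt.mp fun hlt => hv (Finset.mem_filter.mpr ⟨hvs, hlt⟩)) (p1 v)
      · exact p3 v hvs
    have hmono : levelCell h x r ⊆ levelCell h x s := fun q hq => by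
      obtain ⟨q1, q2, q3, q4⟩ := mem_levelCell.mp hq
      exact mem_levelCell.mpr ⟨q1, q2, fun v hv => q3 v fun hvr => hv (hrs hvr), q4⟩
    obtain ⟨⟨a, h1, h2, _⟩, b, h3, h4, _⟩ := exists_lt_of_mem_levelCell hx hpr
    have hbot : levelDirection h r = ⊥ := by
      rw [Submodule.eq_bot_iff]
      intro u hu
      obtain ⟨e, he, k1, k2⟩ := exists_perturbation hpr
        (fun v hv => (Finset.mem_filter.mp hv).2) hu
      have k3 := hext _ (hmono k1) _ (hmono k2)
        ⟨1 / 2, 1 / 2, by norm_num, by norm_num, by norm_num, by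
          rw [← smul_add, add_add_sub_cancel, smul_add, ← add_smul]
          norm_num⟩
      rw [add_eq_left] at k3
      exact (smul_eq_zero.mp k3).resolve_left he.ne'
    have hcard := finrank_levelDirection h1 h3 (h2.trans h4).ne
    rw [hbot, finrank_bot, zero_add] at hcard
    have hab : a ≠ b := fun e => absurd (h2.trans h4) (by rw [e]; exact lt_irrefl _)
    have hr : r = {a, b} := by
      symm
      refine Finset.eq_of_subset_of_card_le (Finset.insert_subset h1
        (Finset.singleton_subset_iff.mpr h3)) ?_
      rw [Finset.card_pair hab, hcard]
    rw [hr] at hpr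
    refine ⟨(a, b), ?_, (eq_edgePoint h2 h4 hpr).symm⟩
    simp only [Finset.coe_product, Finset.coe_filter, Set.mem_prod, Set.mem_ofPred_eq]
    exact ⟨⟨hrs h1, h2⟩, hrs h3, h4⟩
  · rintro ⟨⟨a, b⟩, hab, rfl⟩
    simp only [Finset.coe_product, Finset.coe_filter, Set.mem_prod, Set.mem_ofPred_eq] at hab
    obtain ⟨⟨h1, h2⟩, h3, h4⟩ := hab
    refine ⟨edgePoint_mem h1 h3 h2 h4, ?_⟩
    rintro q hq r hr ⟨c, d, hc, hd, _, hcd⟩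
    obtain ⟨q1, q2, _, q4⟩ := mem_levelCell.mp hq
    obtain ⟨r1, _⟩ := mem_levelCell.mp hr
    refine eq_edgePoint h2 h4 (mem_levelCell.mpr ⟨q1, q2, fun v hv => ?_, q4⟩)
    simp only [Finset.mem_insert, Finset.mem_singleton, not_or] at hv
    have h5 := congrFun hcd v
    rw [edgePoint_of_ne hv.1 hv.2] at h5
    simp only [Pi.add_apply, Pi.smul_apply, smul_eq_mul] at h5
    have h6 := mul_nonneg hc.le (q1 v)
    have h7 := mul_nonneg hd.le (r1 v)
    exact (mul_eq_zero.mp (le_antisymm (by linarith) h6)).resolve_left hc.ne'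

/-- A crossing point determines its edge, because exactly its two ends have positive coordinates. -/
theorem ncard_extremePoints_levelCell (hx : ∀ v, h v ≠ x) :
    ((levelCell h x s).extremePoints ℝ).ncard = #{v ∈ s | h v < x} * #{v ∈ s | x < h v} := by
  rw [extremePoints_levelCell hx, Set.InjOn.ncard_image, Set.ncard_coe_finset,
    Finset.card_product]
  rintro ⟨a, b⟩ hab ⟨c, d⟩ hcd heq
  simp only [Finset.coe_product, Finset.coe_filter, Set.mem_prod, Set.mem_ofPred_eq] at hab hcd
  obtain ⟨⟨_, h2⟩, _, h4⟩ := hab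
  obtain ⟨⟨_, k2⟩, _, k4⟩ := hcd
  have h5 := edgePoint_fst_pos h2 h4
  have h6 := edgePoint_snd_pos h2 h4
  rw [heq] at h5 h6
  have e1 : a = c := by
    by_contra hn
    refine h5.ne' (edgePoint_of_ne hn fun e => ?_)
    rw [e] at h2
    exact absurd (h2.trans k4) (lt_irrefl _)
  have e2 : b = d := by
    by_contra hn
    refine h6.ne' (edgePoint_of_ne (fun e => ?_) hn)
    rw [e] at h4
    exact absurd (h4.trans k2) (lt_irrefl _)
  rw [e1, e2]

end

end CombSlicing

/-! ### Quadrilaterals and the Euler characteristic of a slicing -/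

namespace CombSlicing

open Finset

section
variable {V : Type*} [Fintype V] [DecidableEq V] {M : AbstractSimplicialComplex V}
  {f : (V → ℝ) → ℝ} {x : ℝ}

theorem upperVertices_eq_compl (hx : ∀ v : V, x ≠ f (vertexPoint v)) :
    upperVertices f x = (lowerVertices f x)ᶜ := by
  ext v
  simp only [upperVertices, lowerVertices, Finset.mem_compl, Finset.mem_filter, Finset.mem_univ,
    true_and, not_lt]
  exact ⟨le_of_lt, fun h => lt_of_le_of_ne h (hx v)⟩

theorem IsRsl.levelSet_inter_closedSimplex (hf : IsRsl M f) {s : Finset V} (hs : s ∈ M.faces) :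
    {p | p ∈ closedSimplex s ∧ f p = x} = levelCell (fun v => f (vertexPoint v)) x s := by
  ext p
  refine and_congr_right fun hp => ?_
  rw [hf.2 s hs p hp, Finset.sum_subset (Finset.subset_univ s) fun v _ hv => by
    rw [hp.2 v hv, zero_mul]]

theorem mem_mixedFaces_iff_nonempty (hx : ∀ v : V, x ≠ f (vertexPoint v)) {s : Finset V} :
    s ∈ mixedFaces M (lowerVertices f x) ↔
      s ∈ M.faces ∧ (levelCell (fun v => f (vertexPoint v)) x s).Nonempty := by
  rw [mem_mixedFaces, levelCell_nonempty_iff fun v => (hx v).symm, Finset.not_subset,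
    Finset.not_disjoint_iff, and_comm (a := ∃ a ∈ s, a ∉ lowerVertices f x)]
  simp only [lowerVertices, Finset.mem_filter, Finset.mem_univ, true_and, not_lt]
  refine and_congr_right fun _ => and_congr_right fun _ => exists_congr fun v =>
    and_congr_right fun _ => ⟨fun h => lt_of_le_of_ne h (hx v), le_of_lt⟩

theorem cells_eq_image (hf : IsRsl M f) (hx : ∀ v : V, x ≠ f (vertexPoint v)) :
    cells M f x = levelCell (fun v => f (vertexPoint v)) x ''
      (mixedFaces M (lowerVertices f x) : Set (Finset V)) := by
  ext C
  simp only [cells, Set.mem_ofPred_eq, Set.mem_image, Finset.mem_coe,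
    mem_mixedFaces_iff_nonempty hx]
  constructor
  · rintro ⟨h1, s, hs, rfl⟩
    rw [hf.levelSet_inter_closedSimplex hs] at h1 ⊢
    exact ⟨s, ⟨hs, h1⟩, rfl⟩
  · rintro ⟨s, ⟨hs, h1⟩, rfl⟩
    exact ⟨h1, s, hs, (hf.levelSet_inter_closedSimplex hs).symm⟩

theorem injOn_levelCell (hx : ∀ v : V, x ≠ f (vertexPoint v)) :
    Set.InjOn (levelCell (fun v => f (vertexPoint v)) x)
      (mixedFaces M (lowerVertices f x) : Set (Finset V)) := by
  intro s hs t ht hst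
  rw [Finset.mem_coe, mem_mixedFaces_iff_nonempty hx] at hs ht
  have hx' : ∀ v : V, f (vertexPoint v) ≠ x := fun v => (hx v).symm
  exact (subset_of_levelCell_subset hx' hs.2 hst.subset).antisymm
    (subset_of_levelCell_subset hx' ht.2 hst.symm.subset)

theorem eulerChar_eq_sum (hf : IsRsl M f) (hx : ∀ v : V, x ≠ f (vertexPoint v)) :
    eulerChar M f x = ∑ s ∈ mixedFaces M (lowerVertices f x), (-1 : ℤ) ^ #s := by
  unfold eulerChar
  rw [cells_eq_image hf hx, finsum_mem_image (injOn_levelCell hx), finsum_mem_coe_finset]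
  refine Finset.sum_congr rfl fun s hs => ?_
  -- The shift by two between dimension and number of vertices does not affect the sign.
  rw [← cellDim_levelCell (fun v => (hx v).symm) ((mem_mixedFaces_iff_nonempty hx).mp hs).2,
    pow_add]
  norm_num

/-- With `m` vertices below and `n` above, the cell has dimension `m + n - 2` and `m * n` vertices.
The equations `m + n = 4` and `m * n = 4` force `m = n = 2`. -/
theorem isQuad_levelCell_iff (hx : ∀ v : V, x ≠ f (vertexPoint v)) {s : Finset V}
    (hs : s ∈ mixedFaces M (lowerVertices f x)) :
    IsQuad (levelCell (fun v => f (vertexPoint v)) x s) ↔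
      #s = 4 ∧ #(s ∩ lowerVertices f x) = 2 := by
  have hx' : ∀ v : V, f (vertexPoint v) ≠ x := fun v => (hx v).symm
  have h1 := cellDim_levelCell hx' ((mem_mixedFaces_iff_nonempty hx).mp hs).2
  have h2 := card_inter_compl_add (lowerVertices f x) s
  have e1 : s.filter (fun v => f (vertexPoint v) < x) = s ∩ lowerVertices f x := by
    ext v
    simp [lowerVertices]
  have e2 : s.filter (fun v => x < f (vertexPoint v)) = s ∩ (lowerVertices f x)ᶜ := by
    rw [← upperVertices_eq_compl hx]
    ext v
    simp [upperVertices]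
  unfold IsQuad
  rw [ncard_extremePoints_levelCell hx', e1, e2]
  generalize #(s ∩ lowerVertices f x) = m at *
  generalize #(s ∩ (lowerVertices f x)ᶜ) = n at *
  constructor
  · rintro ⟨h3, h4⟩
    have h5 : #s = 4 := by omega
    have h6 : m ≤ 4 := by omega
    obtain rfl : n = 4 - m := by omega
    refine ⟨h5, ?_⟩
    interval_cases m <;> omega
  · rintro ⟨h3, rfl⟩
    obtain rfl : n = 2 := by omega
    exact ⟨by omega, rfl⟩

theorem numQuads_eq_card (hf : IsRsl M f) (hx : ∀ v : V, x ≠ f (vertexPoint v)) :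
    numQuads M f x = #{s ∈ faceFinset M | #s = 4 ∧ #(s ∩ lowerVertices f x) = 2} := by
  have hmixed : ∀ s ∈ M.faces, #s = 4 → #(s ∩ lowerVertices f x) = 2 →
      s ∈ mixedFaces M (lowerVertices f x) := by
    intro s hs h1 h2
    refine mem_mixedFaces.mpr ⟨hs, fun h => ?_,
      Finset.not_disjoint_iff_nonempty_inter.mpr (Finset.card_pos.mp (by omega))⟩
    rw [Finset.inter_eq_left.mpr h] at h2
    omega
  have h : {C | C ∈ cells M f x ∧ IsQuad C} = levelCell (fun v => f (vertexPoint v)) x ''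
      (({s ∈ faceFinset M | #s = 4 ∧ #(s ∩ lowerVertices f x) = 2} : Finset (Finset V)) :
        Set (Finset V)) := by
    ext C
    rw [Set.mem_ofPred_eq, cells_eq_image hf hx]
    simp only [Set.mem_image, Finset.coe_filter, Set.mem_ofPred_eq, mem_faceFinset,
      Finset.mem_coe]
    constructor
    · rintro ⟨⟨s, hs, rfl⟩, hC⟩
      exact ⟨s, ⟨(mem_mixedFaces.mp hs).1, (isQuad_levelCell_iff hx hs).mp hC⟩, rfl⟩
    · rintro ⟨s, ⟨hs, h1, h2⟩, rfl⟩
      have := hmixed s hs h1 h2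
      exact ⟨⟨s, this, rfl⟩, (isQuad_levelCell_iff hx this).mpr ⟨h1, h2⟩⟩
  unfold numQuads
  rw [h, Set.InjOn.ncard_image ((injOn_levelCell (M := M) hx).mono fun s hs => ?_),
    Set.ncard_coe_finset]
  rw [Finset.mem_coe, Finset.mem_filter, mem_faceFinset] at hs
  exact hmixed s hs.1 hs.2.1 hs.2.2

theorem IsCombManifold.le_numQuads (hM : IsCombManifold 3 M) (hf : IsRsl M f)
    (hx : ∀ v : V, x ≠ f (vertexPoint v)) {W : Finset V}
    (hW : W = lowerVertices f x ∨ W = (lowerVertices f x)ᶜ)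
    (hdim : HasDim (inducedSpan M.toPreAbstractSimplicialComplex W) 1) :
    (numQuads M f x : ℚ) ≥ 3 * ((#W : ℚ) + genus M f x - 1) := by
  have h := hM.three_mul_le_card_tetrahedra (A := W) fun t ht htW => hdim.2 t ⟨ht, htW⟩
  have h1 : ∑ t ∈ mixedFaces M W, (-1 : ℤ) ^ #t = eulerChar M f x := by
    rw [eulerChar_eq_sum hf hx]
    rcases hW with rfl | rfl
    · rfl
    · rw [mixedFaces_compl]
  have h2 : #{t ∈ faceFinset M | #t = 4 ∧ #(t ∩ W) = 2} = numQuads M f x := by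
    rw [numQuads_eq_card hf hx]
    rcases hW with rfl | rfl
    · rfl
    · congr 1
      -- Two of four vertices lie above the level exactly when two lie below.
      refine Finset.filter_congr fun t _ => ?_
      have := card_inter_compl_add (lowerVertices f x) t
      omega
  rw [h1, h2] at h
  have h3 : 6 * (#W : ℚ) - 3 * (eulerChar M f x : ℚ) ≤ 2 * (numQuads M f x : ℚ) := by
    exact_mod_cast h
  unfold genus
  linarith

theorem IsCombManifold.hasDim_of_isQuadrangulated (hM : IsCombManifold 3 M) (hf : IsRsl M f)
    (hx : ∀ v : V, x ≠ f (vertexPoint v)) (hS : (slicing M f x).Nonempty)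
    (hconn : IsConnected (realization M)) (hquad : IsQuadrangulated M f x) {W : Finset V}
    (hW : W = lowerVertices f x ∨ W = (lowerVertices f x)ᶜ) :
    HasDim (inducedSpan M.toPreAbstractSimplicialComplex W) 1 := by
  have hmixed : mixedFaces M W = mixedFaces M (lowerVertices f x) := by
    rcases hW with rfl | rfl
    · rfl
    · rw [mixedFaces_compl]
  refine hM.hasDim_inducedSpan hconn ?_ fun t ht hct => ?_
  · obtain ⟨p, hp, hpx⟩ := hS
    obtain ⟨s, hs, hps⟩ := Set.mem_iUnion₂.mp hp
    rw [hmixed]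
    refine ⟨s, (mem_mixedFaces_iff_nonempty hx).mpr ⟨hs, p, ?_⟩⟩
    rw [← hf.levelSet_inter_closedSimplex hs]
    exact ⟨hps, hpx⟩
  · rw [hmixed] at ht
    have h1 := cellDim_levelCell (fun v => (hx v).symm) ((mem_mixedFaces_iff_nonempty hx).mp ht).2
    have h2 : levelCell (fun v => f (vertexPoint v)) x t ∈ cells M f x := by
      rw [cells_eq_image hf hx]
      exact Set.mem_image_of_mem _ ht
    have h3 := ((isQuad_levelCell_iff hx ht).mp (hquad _ h2 (by omega))).2
    have := card_inter_compl_add (lowerVertices f x) t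
    rcases hW with rfl | rfl <;> omega

end

end CombSlicing

theorem mainTheorem2 {V : Type*} [Fintype V] [DecidableEq V]
    (M : AbstractSimplicialComplex V) (hM : CombSlicing.IsCombManifold 3 M)
    (f : (V → ℝ) → ℝ) (hf : CombSlicing.IsRsl M f)
    (x : ℝ) (hx : ∀ v : V, x ≠ f (CombSlicing.vertexPoint v))
    (hS : IsConnected (CombSlicing.slicing M f x)) :
    (∀ W : Finset V,
      W = CombSlicing.lowerVertices f x ∨ W = CombSlicing.upperVertices f x →
      CombSlicing.HasDim (CombSlicing.inducedSpan M.toPreAbstractSimplicialComplex W) 1 →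
      (CombSlicing.numQuads M f x : ℚ) ≥ 3 * ((W.card : ℚ) + CombSlicing.genus M f x - 1)) ∧
    (IsConnected (CombSlicing.realization M) → CombSlicing.IsQuadrangulated M f x →
      ∀ W : Finset V,
        W = CombSlicing.lowerVertices f x ∨ W = CombSlicing.upperVertices f x →
        CombSlicing.HasDim (CombSlicing.inducedSpan M.toPreAbstractSimplicialComplex W) 1 ∧
        (CombSlicing.numQuads M f x : ℚ) ≥
          3 * ((W.card : ℚ) + CombSlicing.genus M f x - 1)) := by
  rw [CombSlicing.upperVertices_eq_compl hx]
  refine ⟨fun W hW hdim => hM.le_numQuads hf hx hW hdim, fun hconn hquad W hW => ?_⟩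
  have hdim := hM.hasDim_of_isQuadrangulated hf hx hS.nonempty hconn hquad hW
  exact ⟨hdim, hM.le_numQuads hf hx hW hdim⟩
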